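/- A cactus is a finite simple connected graph in which any two distinct cycles have at most one common vertex; a vertex is pendant if its degree $d(v)$ is $1$. Let $\mathcal C_n^k$ be the set of cacti with $n$ vertices exactly $k$ of which are pendant. For a real number $c>0$ let $\prod_{1,c}(G)=\prod_{v\in V(G)}d(v)^c$. Suppose $n\ge k+4$. **(a) The case $k=0$.** Let $t\ge 0$ be an integer. The maximum of $\prod_{1,c}$ over $\mathcal C_n^0$ equals $$16^c\ \text{ if } n=4,\qquad 2^{(3t+6)c}\ \text{ if } n=2t+5,\qquad 2^{(3t+4)c}\,9^c\ \text{ if } n=2t+6,$$ and a graph in $\mathcal C_n^0$ attains it if and only if its degree sequence is, respectively, $2,2,2,2$; $\ \underbrace{4,\dots,4}_{t+1},\underbrace{2,\dots,2}_{t+4}$; $\ \underbrace{4,\dots,4}_{t},3,3,\underbrace{2,\dots,2}_{t+4}$. **(b) The case $k\neq 0$.** If $G\in\mathcal C_n^k$ attains the maximum of $\prod_{1,c}$ over $\mathcal C_n^k$, then at least one of the following holds: (i) $|d(u)-d(v)|\le 1$ for all non-pendant vertices $u,v$ of $G$; (ii) every non-pendant vertex of $G$ has degree $2$, $3$ or $4$;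 no cycle of $G$ has length greater than $3$; every dense path of $G$ has length $1$, except for at most one, whose length is $2$; and every path of $G$ that connects only two cycles has length $0$, except for at most one, whose length is $1$. Here a *dense path* of length $p\ge1$ is an induced subgraph $G[\{u_1,\dots,u_p,v_1,\dots,v_r\}]$ with $r\ge 1$, where each $u_1u_2\cdots u_pv_i$ is a path of $G$ ending in a pendant vertex $v_i$, at most one cycle of $G$ meets these paths, and such a cycle meets them in $u_1$ only. A path $z_1z_2\cdots z_q$ of $G$, of length $q-1$, *connects only two cycles* if there are distinct cycles $C_1,C_2$ of $G$ such that the path meets $C_1$ in exactly $z_1$ and $C_2$ in exactly $z_q$ and has no vertex in common with any other cycle of $G$. Paths are counted as subgraphs, that is, without direction. -/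

import Mathlib

/-- The set of cycles of `G`, each regarded as a subgraph of `G`. -/
def SimpleGraph.cycleSubgraphs {V : Type*} (G : SimpleGraph V) : Set G.Subgraph :=
  {C | ∃ (v : V) (p : G.Walk v v), p.IsCycle ∧ p.toSubgraph = C}

/-- A cactus: a connected graph in which any two distinct cycles have at most one common vertex. -/
def SimpleGraph.IsCactus {V : Type*} (G : SimpleGraph V) : Prop :=
  G.Connected ∧ ∀ C₁ ∈ G.cycleSubgraphs, ∀ C₂ ∈ G.cycleSubgraphs, C₁ ≠ C₂ →
    (C₁.verts ∩ C₂.verts).Subsingleton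

open Classical in
/-- The degree of a vertex of a finite graph. -/
noncomputable def SimpleGraph.deg {V : Type*} [Fintype V] (G : SimpleGraph V) (v : V) : ℕ :=
  G.degree v

/-- The degree sequence, as a multiset. -/
noncomputable def SimpleGraph.degSeq {V : Type*} [Fintype V] (G : SimpleGraph V) : Multiset ℕ :=
  Finset.univ.val.map G.deg

/-- The first generalized multiplicative Zagreb index, the product of the `c`-th powers of the
degrees. -/
noncomputable def SimpleGraph.zagrebProd {V : Type*} [Fintype V] (c : ℝ) (G : SimpleGraph V) : ℝ :=
  ∏ v, (G.deg v : ℝ) ^ c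

/-- The cacti with vertex set `Fin n` that have exactly `k` pendant vertices (vertices of
degree one). -/
def cacti (n k : ℕ) : Set (SimpleGraph (Fin n)) :=
  {G | G.IsCactus ∧ {v | G.deg v = 1}.ncard = k}

/-- The non-pendant vertices have degrees that differ by at most one. -/
def SimpleGraph.NonpendantBalanced {V : Type*} [Fintype V] (G : SimpleGraph V) : Prop :=
  ∀ u v, G.deg u ≠ 1 → G.deg v ≠ 1 → |(G.deg u : ℤ) - (G.deg v : ℤ)| ≤ 1

/-- The vertices of the dense path with trunk `p` and set of pendant end vertices `R`. -/
def SimpleGraph.densePathVerts {V : Type*} {G : SimpleGraph V} {u w : V} (p : G.Walk u w)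
    (R : Set V) : Set V :=
  {x | x ∈ p.support} ∪ R

/-- The walk `p = u₁u₂…u_m` and the non-empty set `R = {v₁, …, v_r}` form a dense path: every
`u₁u₂…u_m v_i` is a path of `G` that ends in the pendant vertex `v_i`, there is at most one cycle
of `G` that meets these paths, and such a cycle meets them in `u₁` only.
The subgraph that `G` induces on `densePathVerts p R` is the dense path itself; the length of each
of its paths `u₁u₂…u_m v_i` is `p.length + 1`. -/
structure SimpleGraph.IsDensePath {V : Type*} [Fintype V] (G : SimpleGraph V) {u w : V}
    (p : G.Walk u w) (R : Set V) : Prop where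
  nonempty : R.Nonempty
  pendant : ∀ v ∈ R, G.deg v = 1
  isPath : ∀ v ∈ R, ∃ h : G.Adj w v, (p.concat h).IsPath
  cycle_unique : {C | C ∈ G.cycleSubgraphs ∧
    (densePathVerts p R ∩ C.verts).Nonempty}.Subsingleton
  cycle_inter : ∀ C ∈ G.cycleSubgraphs, (densePathVerts p R ∩ C.verts).Nonempty →
    densePathVerts p R ∩ C.verts = {u}

/-- The walk `p` is a path that connects only two cycles: there are two distinct cycles such
that `p` meets the one exactly in its first vertex, the other exactly in its last vertex, and
has no vertex in common with any further cycle. -/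
def SimpleGraph.ConnectsOnlyTwoCycles {V : Type*} (G : SimpleGraph V) {x y : V}
    (p : G.Walk x y) : Prop :=
  p.IsPath ∧ ∃ C₁ ∈ G.cycleSubgraphs, ∃ C₂ ∈ G.cycleSubgraphs, C₁ ≠ C₂ ∧
    {z | z ∈ p.support} ∩ C₁.verts = {x} ∧ {z | z ∈ p.support} ∩ C₂.verts = {y} ∧
    ∀ C ∈ G.cycleSubgraphs, C ≠ C₁ → C ≠ C₂ → Disjoint {z | z ∈ p.support} C.verts

/-- No cycle is longer than three. -/
def SimpleGraph.CyclesAreTriangles {V : Type*} (G : SimpleGraph V) : Prop :=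
  ∀ (v : V) (p : G.Walk v v), p.IsCycle → p.length ≤ 3

/-- Every dense path has length one, except for at most one dense path, of length two. -/
def SimpleGraph.DensePathsRestricted {V : Type*} [Fintype V] (G : SimpleGraph V) : Prop :=
  (∀ (u w : V) (p : G.Walk u w) (R : Set V), G.IsDensePath p R → p.length + 1 ≤ 2) ∧
  (∀ (u w : V) (p : G.Walk u w) (R : Set V) (u' w' : V) (p' : G.Walk u' w') (R' : Set V),
    G.IsDensePath p R → G.IsDensePath p' R' → 1 < p.length + 1 → 1 < p'.length + 1 →
    densePathVerts p R = densePathVerts p' R')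

/-- Every path connecting only two cycles has length zero, except for at most one such path,
of length one. -/
def SimpleGraph.ConnectingPathsRestricted {V : Type*} (G : SimpleGraph V) : Prop :=
  (∀ (x y : V) (p : G.Walk x y), G.ConnectsOnlyTwoCycles p → p.length ≤ 1) ∧
  (∀ (x y : V) (p : G.Walk x y) (x' y' : V) (p' : G.Walk x' y'),
    G.ConnectsOnlyTwoCycles p → G.ConnectsOnlyTwoCycles p' → 0 < p.length → 0 < p'.length →
    p.toSubgraph = p'.toSubgraph)

/-! Since `c > 0`, only the product of the degrees matters, and pendant vertices contribute the
factor 1. In a cactus each edge lies on at most one cycle, so a vertex on `a` cycles with `q`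
further edges has degree `2a + q`. The key local estimate is `2a + q ≤ 2^a (3/2)^q`, with equality
exactly for `(a, q) = (1, 0), (1, 1), (2, 0)`, that is, for degrees 2, 3, 4 of a special kind.

Let `N` be the number of non-pendant vertices, `r` the number of cycles, `A ≥ 3r` the sum of all
`a`, and `D` the number of ordered pairs of non-pendant vertices joined by an edge on no cycle. The
product is at most `2^A (3/2)^(D + k)`, and counting edges gives `2A + D + 2 = 2N + 2r`. Giving up a
triangle (factor 8) makes room for at most two bridges (factor 9/4 each), and `(9/4)^2 < 8`; so for
`N = 2R + 1 + ε`, `ε ≤ 1`, the bound is `8^R (9/4)^ε (3/2)^k`. Equality forces `IsTight` and `D =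
2ε`, from which the degree sequences of (a) and alternative (ii) of (b) are read off.

Gluing triangles and hanging pendant vertices on them attains this bound if `N ≥ 3`, `N ≠ 4` and `k
≤ R + 2`. For larger `k`, and for `N = 4` with `k ≠ 0`, there is a cactus with non-pendant degrees
differing by at most one and with the largest possible degree sum. By log-concavity it beats every
unbalanced competitor, which gives (i). For `n = 4`, `k = 0` the edge count forces all degrees to be
2. -/

namespace SimpleGraph

open Finset

/-! ### Cycles as subgraphs and their transfer along injective homomorphisms -/

section Cycles

variable {V W : Type*} {G : SimpleGraph V} {H : SimpleGraph W}

theorem Subgraph.verts_subset_of_closed {C : G.Subgraph} (hC : C.Connected) {S : Set V} {v : V}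
    (hv : v ∈ C.verts) (hvS : v ∈ S) (hS : ∀ a ∈ S, ∀ b, C.Adj a b → b ∈ S) : C.verts ⊆ S := by
  intro w hw
  obtain ⟨p⟩ := hC.coe.preconnected ⟨v, hv⟩ ⟨w, hw⟩
  have key : ∀ a b : C.verts, C.coe.Walk a b → (a : V) ∈ S → (b : V) ∈ S := by
    intro a b p
    induction p with
    | nil => exact id
    | cons h _ ih => exact fun ha => ih (hS _ ha _ h)
  exact key _ _ p hvS

theorem Connected.eq_univ_of_closed (hG : G.Connected) {S : Set V} {v : V} (hvS : v ∈ S)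
    (hS : ∀ a ∈ S, ∀ b, G.Adj a b → b ∈ S) : S = Set.univ := by
  refine Set.eq_univ_of_forall fun w => ?_
  obtain ⟨p⟩ := hG.preconnected v w
  have key : ∀ a b, G.Walk a b → a ∈ S → b ∈ S := by
    intro a b p
    induction p with
    | nil => exact id
    | cons h _ ih => exact fun ha => ih (hS _ ha _ h)
  exact key _ _ p hvS

theorem connected_of_mem_cycleSubgraphs {C : G.Subgraph} (hC : C ∈ G.cycleSubgraphs) :
    C.Connected := by
  obtain ⟨v, p, -, rfl⟩ := hC
  exact p.toSubgraph_connected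

theorem ncard_neighborSet_of_mem_cycleSubgraphs {C : G.Subgraph} (hC : C ∈ G.cycleSubgraphs)
    {v : V} (hv : v ∈ C.verts) : (C.neighborSet v).ncard = 2 := by
  obtain ⟨u, p, hp, rfl⟩ := hC
  exact hp.ncard_neighborSet_toSubgraph_eq_two (p.mem_verts_toSubgraph.1 hv)

theorem Walk.IsCycle.ncard_verts {v : V} {p : G.Walk v v} (hp : p.IsCycle) :
    p.toSubgraph.verts.ncard = p.length := by
  classical
  have h : p.toSubgraph.verts = (p.support.tail.toFinset : Set V) := by
    ext w
    rw [Walk.mem_verts_toSubgraph, List.coe_toFinset, Set.mem_ofPred_eq, Walk.mem_support_iff]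
    constructor
    · rintro (rfl | h)
      · exact Walk.end_mem_tail_support hp.not_nil
      · exact h
    · exact Or.inr
  rw [h, Set.ncard_coe_finset, List.toFinset_card_of_nodup hp.support_nodup]
  simp

theorem three_le_ncard_verts {C : G.Subgraph} (hC : C ∈ G.cycleSubgraphs) :
    3 ≤ C.verts.ncard := by
  obtain ⟨v, p, hp, rfl⟩ := hC
  rw [hp.ncard_verts]
  exact hp.three_le_length

theorem Walk.exists_map_eq_of_forall_edges (f : G →g H) {x y : W} (p : H.Walk x y)
    (hp : ∀ a b, s(a, b) ∈ p.edges → ∃ a₀ b₀, f a₀ = a ∧ f b₀ = b ∧ G.Adj a₀ b₀)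
    (hf : Function.Injective f) {u : V} (hu : f u = x) :
    ∃ (v : V) (q : G.Walk u v) (hv : f v = y), (q.map f).copy hu hv = p := by
  induction p generalizing u with
  | nil => exact ⟨u, .nil, hu, by subst hu; rfl⟩
  | @cons a b c h p ih =>
    obtain ⟨a₀, b₀, ha, hb, hab⟩ := hp a b (by simp)
    obtain rfl : a₀ = u := hf (ha.trans hu.symm)
    obtain ⟨v, q, hv, hq⟩ := ih (fun a b h => hp a b (by simp [h])) hb
    refine ⟨v, .cons hab q, hv, ?_⟩
    subst ha hb hv
    rw [← hq]
    rfl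

theorem map_mem_cycleSubgraphs (f : G →g H) (hf : Function.Injective f) {C : G.Subgraph}
    (hC : C ∈ G.cycleSubgraphs) : C.map f ∈ H.cycleSubgraphs := by
  obtain ⟨v, p, hp, rfl⟩ := hC
  exact ⟨f v, p.map f, hp.map hf, p.toSubgraph_map f⟩

/-- Only the edges of the cycle itself must come from `G`, so `f` need not be an embedding. This
serves edge deletion, isomorphisms and gluing alike. -/
theorem exists_map_eq_of_mem_cycleSubgraphs (f : G →g H) (hf : Function.Injective f)
    {C : H.Subgraph} (hC : C ∈ H.cycleSubgraphs)
    (hadj : ∀ a b, C.Adj a b → ∃ a₀ b₀, f a₀ = a ∧ f b₀ = b ∧ G.Adj a₀ b₀) :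
    ∃ C₀ ∈ G.cycleSubgraphs, C₀.map f = C := by
  obtain ⟨x, p, hp, rfl⟩ := hC
  have hadj' : ∀ a b, s(a, b) ∈ p.edges → ∃ a₀ b₀, f a₀ = a ∧ f b₀ = b ∧ G.Adj a₀ b₀ :=
    fun a b h => hadj a b (Walk.adj_toSubgraph_iff_mem_edges.2 h)
  obtain ⟨u, -, hu, -, -⟩ := hadj _ _ (p.toSubgraph_adj_snd hp.not_nil)
  obtain ⟨v, q, hv, rfl⟩ := p.exists_map_eq_of_forall_edges f hadj' hf hu
  obtain rfl : v = u := hf (hv.trans hu.symm)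
  subst hu
  refine ⟨q.toSubgraph, ⟨_, q, ?_, rfl⟩, ?_⟩
  · exact (Walk.isCycle_map_iff_of_injective hf).1 hp
  · exact (q.toSubgraph_map f).symm

theorem Subgraph.map_injective_of_injective (f : G →g H) (hf : Function.Injective f) :
    Function.Injective (Subgraph.map f) := by
  intro A B h
  have hv : A.verts = B.verts := hf.image_injective (congrArg Subgraph.verts h)
  refine Subgraph.ext hv ?_
  ext a b
  have := congrArg (fun C : H.Subgraph => C.Adj (f a) (f b)) h
  simpa [Subgraph.map, Relation.map_apply, hf.eq_iff] using this

theorem IsCactus.eq_of_adj (hG : G.IsCactus) {C D : G.Subgraph} (hC : C ∈ G.cycleSubgraphs)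
    (hD : D ∈ G.cycleSubgraphs) {a b : V} (h₁ : C.Adj a b) (h₂ : D.Adj a b) : C = D := by
  by_contra hne
  exact h₁.ne (hG.2 C hC D hD hne ⟨h₁.fst_mem, h₂.fst_mem⟩ ⟨h₁.snd_mem, h₂.snd_mem⟩)

/-- Distinct images of cycles of a cactus under an injective homomorphism share at most one
vertex. -/
theorem pairwise_subsingleton_of_map (f : G →g H) (hf : Function.Injective f) (hG : G.IsCactus)
    {C D : G.Subgraph} (hC : C ∈ G.cycleSubgraphs) (hD : D ∈ G.cycleSubgraphs)
    (hne : C.map f ≠ D.map f) : ((C.map f).verts ∩ (D.map f).verts).Subsingleton := by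
  have : (C.map f).verts ∩ (D.map f).verts = f '' (C.verts ∩ D.verts) :=
    (Set.image_inter hf).symm
  rw [this]
  exact (hG.2 C hC D hD (fun h => hne (h ▸ rfl))).image f

end Cycles

/-! ### Edge count of a cactus -/

section Counting

variable {V : Type*} [Fintype V] {G : SimpleGraph V}

/-- An edge of a cycle lies on no other cycle, so deleting it destroys exactly one cycle and keeps
the graph connected. Induction on the number of cycles ends at a tree. -/
theorem IsCactus.ncard_edgeSet_add_one (hG : G.IsCactus) :
    G.edgeSet.ncard + 1 = Fintype.card V + G.cycleSubgraphs.ncard := by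
  classical
  induction hr : G.cycleSubgraphs.ncard generalizing G with
  | zero =>
    have h0 : G.cycleSubgraphs = ∅ := (Set.ncard_eq_zero (Set.toFinite _)).1 hr
    have ht : G.IsTree := ⟨hG.1, fun v p hp => by
      have : p.toSubgraph ∈ G.cycleSubgraphs := ⟨v, p, hp, rfl⟩
      simp [h0] at this⟩
    rw [← ht.card_edgeFinset, ← Set.ncard_coe_finset, coe_edgeFinset]
  | succ r ih =>
    have hne : G.cycleSubgraphs.Nonempty := Set.nonempty_of_ncard_ne_zero (by omega)
    obtain ⟨_, v, p, hp, rfl⟩ := hne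
    set C := p.toSubgraph with hCdef
    have hC : C ∈ G.cycleSubgraphs := ⟨v, p, hp, rfl⟩
    obtain ⟨b, hadj⟩ : ∃ b, C.Adj v b := ⟨_, p.toSubgraph_adj_snd hp.not_nil⟩
    have hGadj : G.Adj v b := hadj.adj_sub
    have hbr : ¬ G.IsBridge s(v, b) := by
      rw [isBridge_iff_forall_cycle_notMem hGadj]
      exact fun h => h p hp (Walk.adj_toSubgraph_iff_mem_edges.1 hadj)
    set G' := G.deleteEdges {s(v, b)} with hG'
    have hconn : G'.Connected := hG.1.connected_delete_edge_of_not_isBridge hbr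
    let f : G' →g G := Hom.ofLE (deleteEdges_le _)
    have hf : Function.Injective f := fun _ _ h => h
    have himg : Subgraph.map f '' G'.cycleSubgraphs = G.cycleSubgraphs \ {C} := by
      ext D
      constructor
      · rintro ⟨D, hD, rfl⟩
        refine ⟨map_mem_cycleSubgraphs f hf hD, fun hDC => ?_⟩
        rw [Set.mem_singleton_iff] at hDC
        rw [← hDC] at hadj
        simp only [Subgraph.map, Relation.map_apply] at hadj
        obtain ⟨a', b', h, ha', hb'⟩ := hadj
        have := h.adj_sub
        rw [show a' = v from ha', show b' = b from hb', hG', deleteEdges_adj] at this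
        exact this.2 rfl
      · rintro ⟨hD, hDC⟩
        refine exists_map_eq_of_mem_cycleSubgraphs f hf hD fun a' b' h => ⟨a', b', rfl, rfl, ?_⟩
        rw [hG', deleteEdges_adj]
        refine ⟨h.adj_sub, fun he => hDC ?_⟩
        rw [Set.mem_singleton_iff, Sym2.eq_iff] at he
        rcases he with ⟨rfl, rfl⟩ | ⟨rfl, rfl⟩
        · exact hG.eq_of_adj hD hC h hadj
        · exact hG.eq_of_adj hD hC h.symm hadj
    have hcard : G'.cycleSubgraphs.ncard = r := by
      rw [← Set.ncard_image_of_injective _ (Subgraph.map_injective_of_injective f hf), himg,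
        Set.ncard_sdiff_singleton_of_mem hC, hr]
      rfl
    have hcact : G'.IsCactus := by
      refine ⟨hconn, fun C₁ h₁ C₂ h₂ hne => ?_⟩
      have := hG.2 _ (map_mem_cycleSubgraphs f hf h₁) _ (map_mem_cycleSubgraphs f hf h₂)
        ((Subgraph.map_injective_of_injective f hf).ne hne)
      have h' : ∀ D : G'.Subgraph, (D.map f).verts = D.verts := fun D => Set.image_id _
      rwa [h', h'] at this
    have := ih hcact hcard
    have he : G'.edgeSet = G.edgeSet \ {s(v, b)} := edgeSet_deleteEdges _
    have := Set.ncard_sdiff_singleton_add_one (s := G.edgeSet) (a := s(v, b)) hGadj (Set.toFinite _)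
    rw [← he] at this
    omega

end Counting

end SimpleGraph

namespace SimpleGraph

open Finset

/-! ### Double counting of cycle incidences and of edges on no cycle -/

section OffCycle

variable {V : Type*} {G : SimpleGraph V}

/-- Adjacent by an edge that lies on no cycle. -/
def OffCycle (G : SimpleGraph V) (v w : V) : Prop :=
  G.Adj v w ∧ ∀ C ∈ G.cycleSubgraphs, ¬ C.Adj v w

theorem OffCycle.symm {v w : V} (h : G.OffCycle v w) : G.OffCycle w v :=
  ⟨h.1.symm, fun C hC hC' => h.2 C hC hC'.symm⟩

end OffCycle

section Counting

variable {V : Type*} [Fintype V] {G : SimpleGraph V}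

/-- The finset of cycles of a finite graph. -/
noncomputable def cycleFinset (G : SimpleGraph V) : Finset G.Subgraph :=
  (Set.toFinite G.cycleSubgraphs).toFinset

@[simp]
theorem mem_cycleFinset {C : G.Subgraph} : C ∈ G.cycleFinset ↔ C ∈ G.cycleSubgraphs := by
  simp [cycleFinset]

open Classical in
/-- The number of cycles through a vertex. -/
noncomputable def cycleCount (G : SimpleGraph V) (v : V) : ℕ :=
  #{C ∈ G.cycleFinset | v ∈ C.verts}

open Classical in
/-- The number of edges at a vertex that lie on no cycle. -/
noncomputable def offDegree (G : SimpleGraph V) (v : V) : ℕ :=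
  #{w | G.OffCycle v w}

open Classical in
/-- The non-pendant vertices. -/
noncomputable def nonpendants (G : SimpleGraph V) : Finset V :=
  {v | G.deg v ≠ 1}

@[simp]
theorem mem_nonpendants {v : V} : v ∈ G.nonpendants ↔ G.deg v ≠ 1 := by
  simp [nonpendants]

open Classical in
/-- The ordered pairs of non-pendant vertices joined by an edge that lies on no cycle. -/
noncomputable def innerOffPairs (G : SimpleGraph V) : Finset (V × V) :=
  {e | G.OffCycle e.1 e.2 ∧ G.deg e.1 ≠ 1 ∧ G.deg e.2 ≠ 1}

theorem mem_innerOffPairs {v w : V} :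
    (v, w) ∈ G.innerOffPairs ↔ G.OffCycle v w ∧ G.deg v ≠ 1 ∧ G.deg w ≠ 1 := by
  simp [innerOffPairs]

open Classical in
theorem deg_eq_card_filter (G : SimpleGraph V) (v : V) : G.deg v = #{w | G.Adj v w} := by
  rw [deg, ← card_neighborFinset_eq_degree, neighborFinset_eq_filter]

theorem two_le_deg_of_adj_of_adj {v a b : V} (ha : G.Adj v a) (hb : G.Adj v b) (hab : a ≠ b) :
    2 ≤ G.deg v := by
  classical
  rw [deg_eq_card_filter, ← card_pair hab]
  exact card_le_card fun w hw => by
    rcases mem_insert.1 hw with rfl | hw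
    · simpa
    · rw [mem_singleton.1 hw]; simpa

theorem two_le_deg_of_mem_cycle {C : G.Subgraph} (hC : C ∈ G.cycleSubgraphs) {v : V}
    (hv : v ∈ C.verts) : 2 ≤ G.deg v := by
  obtain ⟨a, b, hab, h⟩ := Set.ncard_eq_two.1 (ncard_neighborSet_of_mem_cycleSubgraphs hC hv)
  have ha : a ∈ C.neighborSet v := by simp [h]
  have hb : b ∈ C.neighborSet v := by simp [h]
  exact two_le_deg_of_adj_of_adj (C.adj_sub ha) (C.adj_sub hb) hab

theorem one_le_deg (hG : G.Connected) (hV : 2 ≤ Fintype.card V) (v : V) : 1 ≤ G.deg v := by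
  classical
  have : Nontrivial V := Fintype.one_lt_card_iff_nontrivial.1 hV
  rw [deg]
  exact (hG.preconnected.degree_pos_of_nontrivial v)

theorem eq_of_adj_of_deg_eq_one {v a b : V} (hv : G.deg v = 1) (ha : G.Adj v a)
    (hb : G.Adj v b) : a = b := by
  by_contra h
  have := two_le_deg_of_adj_of_adj ha hb h
  omega

theorem deg_ne_one_of_adj (hG : G.Connected) (hV : 3 ≤ Fintype.card V) {v w : V}
    (h : G.Adj v w) (hv : G.deg v = 1) : G.deg w ≠ 1 := by
  classical
  intro hw
  have huniv : ({v, w} : Set V) = Set.univ := by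
    refine hG.eq_univ_of_closed (v := v) (by simp) fun a ha b hab => ?_
    rcases ha with rfl | rfl
    · simp [eq_of_adj_of_deg_eq_one hv hab h]
    · simp [eq_of_adj_of_deg_eq_one hw hab h.symm]
  have h1 : ({v, w} : Set V).ncard = 2 := Set.ncard_pair h.ne
  rw [huniv, Set.ncard_univ, Nat.card_eq_fintype_card] at h1
  omega

theorem cycleCount_eq_zero_of_deg_eq_one {v : V} (hv : G.deg v = 1) : G.cycleCount v = 0 := by
  classical
  rw [cycleCount, card_eq_zero, filter_eq_empty_iff]
  intro C hC hvC
  have := two_le_deg_of_mem_cycle (mem_cycleFinset.1 hC) hvC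
  omega

theorem exists_cycle_of_cycleCount_pos {v : V} (hv : 0 < G.cycleCount v) :
    ∃ C ∈ G.cycleSubgraphs, v ∈ C.verts := by
  classical
  obtain ⟨C, hC⟩ := card_pos.1 hv
  rw [mem_filter, mem_cycleFinset] at hC
  exact ⟨C, hC⟩

/-- Every cycle through `v` uses two edges at `v`, and in a cactus different cycles use different
edges. -/
theorem IsCactus.deg_eq (hG : G.IsCactus) (v : V) :
    G.deg v = 2 * G.cycleCount v + G.offDegree v := by
  classical
  have key : ∀ w, (if G.Adj v w then 1 else 0) =
      (∑ C ∈ G.cycleFinset, if C.Adj v w then 1 else 0) + if G.OffCycle v w then 1 else 0 := by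
    intro w
    by_cases hex : ∃ C ∈ G.cycleSubgraphs, C.Adj v w
    · obtain ⟨C, hC, hadj⟩ := hex
      rw [if_pos hadj.adj_sub, if_neg fun h : G.OffCycle v w => h.2 C hC hadj,
        sum_eq_single_of_mem C (mem_cycleFinset.2 hC), if_pos hadj]
      intro D hD hne
      exact if_neg fun h => hne (hG.eq_of_adj (mem_cycleFinset.1 hD) hC h hadj)
    · push Not at hex
      rw [sum_eq_zero fun C hC => if_neg (hex C (mem_cycleFinset.1 hC)), zero_add]
      exact if_congr ⟨fun h => ⟨h, hex⟩, And.left⟩ rfl rfl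
  have hcyc : ∀ C ∈ G.cycleFinset,
      (∑ w, if C.Adj v w then 1 else 0) = if v ∈ C.verts then 2 else 0 := by
    intro C hC
    rw [← card_filter]
    split_ifs with hv
    · rw [← ncard_neighborSet_of_mem_cycleSubgraphs (mem_cycleFinset.1 hC) hv,
        ← Set.ncard_coe_finset]
      congr 1
      ext w
      simp
    · rw [card_eq_zero, filter_eq_empty_iff]
      exact fun w _ h => hv h.fst_mem
  rw [deg_eq_card_filter, card_filter, sum_congr rfl fun w _ => key w, sum_add_distrib, sum_comm,
    sum_congr rfl hcyc, ← card_filter, offDegree, cycleCount, ← sum_filter, sum_const, smul_eq_mul,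
    mul_comm]

theorem sum_cycleCount (G : SimpleGraph V) :
    ∑ v, G.cycleCount v = ∑ C ∈ G.cycleFinset, C.verts.ncard := by
  classical
  simp_rw [cycleCount, card_filter]
  rw [sum_comm]
  refine sum_congr rfl fun C _ => ?_
  rw [← card_filter, ← Set.ncard_coe_finset]
  congr 1
  ext w
  simp

theorem sum_nonpendants_cycleCount (G : SimpleGraph V) :
    ∑ v ∈ G.nonpendants, G.cycleCount v = ∑ v, G.cycleCount v := by
  refine sum_subset (subset_univ _) fun v _ hv => cycleCount_eq_zero_of_deg_eq_one ?_
  simpa using hv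

theorem three_mul_card_cycleFinset_le (G : SimpleGraph V) :
    3 * #G.cycleFinset ≤ ∑ v, G.cycleCount v := by
  rw [sum_cycleCount, mul_comm, ← smul_eq_mul]
  exact card_nsmul_le_sum _ _ _ fun C hC => three_le_ncard_verts (mem_cycleFinset.1 hC)

theorem ncard_verts_of_sum_cycleCount_eq (h : ∑ v, G.cycleCount v = 3 * #G.cycleFinset)
    {C : G.Subgraph} (hC : C ∈ G.cycleSubgraphs) : C.verts.ncard = 3 := by
  rw [sum_cycleCount, mul_comm, ← smul_eq_mul, ← sum_const] at h
  exact ((sum_eq_sum_iff_of_le fun D hD => three_le_ncard_verts (mem_cycleFinset.1 hD)).1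
    h.symm C (mem_cycleFinset.2 hC)).symm

theorem card_nonpendants_add (G : SimpleGraph V) :
    #G.nonpendants + {v | G.deg v = 1}.ncard = Fintype.card V := by
  classical
  have h1 : {v | G.deg v = 1}.ncard = #{v | G.deg v = 1} := by
    rw [← Set.ncard_coe_finset]
    congr 1
    ext; simp
  rw [h1, add_comm, nonpendants, ← card_univ]
  exact card_filter_add_card_filter_not _

/-- The only edge at a pendant vertex lies on no cycle and ends in a non-pendant vertex, so each
pendant vertex is counted once. -/
theorem sum_nonpendants_offDegree (hG : G.Connected) (hV : 3 ≤ Fintype.card V) :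
    ∑ v ∈ G.nonpendants, G.offDegree v = {v | G.deg v = 1}.ncard + #G.innerOffPairs := by
  classical
  have h1 : ∀ v, G.offDegree v =
      (∑ w with G.deg w = 1, if G.OffCycle v w then 1 else 0) + #{w | G.OffCycle v w ∧
        G.deg w ≠ 1} := by
    intro v
    rw [offDegree, ← card_filter_add_card_filter_not (s := {w | G.OffCycle v w})
      fun w => G.deg w = 1, filter_filter, filter_filter, ← card_filter, filter_filter]
    congr 3
    ext; simp [and_comm]
  have h2 : ∀ w ∈ ({w | G.deg w = 1} : Finset V),
      (∑ v ∈ G.nonpendants, if G.OffCycle v w then 1 else 0) = 1 := by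
    intro w hw
    have hw1 : G.deg w = 1 := by simpa using hw
    rw [← card_filter]
    refine Eq.trans ?_ hw1
    rw [deg_eq_card_filter]
    congr 1
    ext v
    simp only [mem_filter, mem_nonpendants, mem_univ, true_and]
    refine ⟨fun h => h.2.1.symm, fun h => ⟨deg_ne_one_of_adj hG hV h hw1, h.symm, ?_⟩⟩
    intro C hC hadj
    have := two_le_deg_of_mem_cycle hC hadj.snd_mem
    omega
  have h3 : ∑ v ∈ G.nonpendants, #{w | G.OffCycle v w ∧ G.deg w ≠ 1} = #G.innerOffPairs := by
    rw [innerOffPairs, card_filter, ← univ_product_univ, sum_product, nonpendants, sum_filter]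
    refine sum_congr rfl fun v _ => ?_
    rw [card_filter]
    split_ifs with hv
    · refine sum_congr rfl fun w _ => ?_
      exact if_congr ⟨fun h => ⟨h.1, hv, h.2⟩, fun h => ⟨h.1, h.2.2⟩⟩ rfl rfl
    · exact (sum_eq_zero fun w _ => if_neg fun h => hv h.2.1).symm
  rw [sum_congr rfl fun v _ => h1 v, sum_add_distrib, h3, sum_comm, sum_congr rfl h2,
    ← card_eq_sum_ones, ← Set.ncard_coe_finset]
  congr 2
  ext; simp

theorem IsCactus.sum_deg_add_two (hG : G.IsCactus) :
    ∑ v, G.deg v + 2 = 2 * (Fintype.card V + #G.cycleFinset) := by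
  classical
  have h1 := hG.ncard_edgeSet_add_one
  have h2 := G.sum_degrees_eq_twice_card_edges
  have h3 : #G.edgeFinset = G.edgeSet.ncard := by
    rw [← Set.ncard_coe_finset, coe_edgeFinset]
  have h4 : G.cycleSubgraphs.ncard = #G.cycleFinset := by
    rw [← Set.ncard_coe_finset]
    congr 1
    ext; simp
  have h5 : ∑ v, G.deg v = ∑ v, G.degree v := rfl
  omega

theorem sum_deg_eq (G : SimpleGraph V) :
    ∑ v, G.deg v = ∑ v ∈ G.nonpendants, G.deg v + {v | G.deg v = 1}.ncard := by
  classical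
  rw [← sum_filter_add_sum_filter_not univ (fun v => G.deg v ≠ 1), nonpendants]
  congr 1
  rw [sum_congr rfl (g := fun _ => 1) (by simp), ← card_eq_sum_ones, ← Set.ncard_coe_finset]
  congr 1
  ext; simp

/-- Two evaluations of the non-pendant degree sum are compared: by the number of edges, and by cycle
incidences plus edges on no cycle. This is the budget in which cycles and bridges compete. -/
theorem IsCactus.card_innerOffPairs_add (hG : G.IsCactus) (hV : 3 ≤ Fintype.card V) :
    2 * ∑ v, G.cycleCount v + #G.innerOffPairs + 2 =
      2 * #G.nonpendants + 2 * #G.cycleFinset := by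
  have h1 := hG.sum_deg_add_two
  have h2 := sum_nonpendants_offDegree hG.1 hV
  have h3 := sum_deg_eq G
  have h4 := card_nonpendants_add G
  have h5 := sum_nonpendants_cycleCount G
  have h6 : ∑ v ∈ G.nonpendants, G.deg v =
      2 * ∑ v, G.cycleCount v + ∑ v ∈ G.nonpendants, G.offDegree v := by
    rw [sum_congr rfl fun v _ => hG.deg_eq v, sum_add_distrib, ← mul_sum, h5]
  omega

end Counting

end SimpleGraph

namespace SimpleGraph

open Finset

/-! ### Numerical inequalities: local weight and exchange of cycles for bridges -/

section WeightBounds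

/-- The left side is the binomial expansion of `(1 + 1/2)^q` up to second order. -/
theorem quadratic_le_three_halves_pow (q : ℕ) :
    1 + (q : ℝ) / 2 + q * (q - 1) / 8 ≤ (3 / 2 : ℝ) ^ q := by
  induction q with
  | zero => norm_num
  | succ q ih =>
    rw [pow_succ]
    push_cast
    have : (0 : ℝ) ≤ q * (q - 1) := by
      rcases Nat.eq_zero_or_pos q with rfl | h
      · simp
      · have : (1 : ℝ) ≤ q := by exact_mod_cast h
        exact mul_nonneg (by positivity) (by linarith)
    nlinarith

/-- The bases 2 and 3/2 are fixed by equality at the three excluded pairs; exponential growth wins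
everywhere else. -/
theorem two_mul_add_lt_weight {c q : ℕ} (h : ¬((c = 1 ∧ q ≤ 1) ∨ (c = 2 ∧ q = 0))) :
    (2 * c + q : ℝ) < 2 ^ c * (3 / 2) ^ q := by
  have hq := quadratic_le_three_halves_pow q
  have hq0 : (0 : ℝ) ≤ q := Nat.cast_nonneg q
  have hqq : (0 : ℝ) ≤ q * (q - 1) := by
    rcases Nat.eq_zero_or_pos q with rfl | h
    · simp
    · have : (1 : ℝ) ≤ q := by exact_mod_cast h
      exact mul_nonneg (by positivity) (by linarith)
  match c, h with
  | 0, _ => norm_num; nlinarith [sq_nonneg ((q : ℝ) - 5 / 2)]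
  | 1, h =>
    have : (2 : ℝ) ≤ q := by
      have : 2 ≤ q := by omega
      exact_mod_cast this
    norm_num
    nlinarith
  | 2, h =>
    have : (1 : ℝ) ≤ q := by
      have : 1 ≤ q := by omega
      exact_mod_cast this
    norm_num
    nlinarith
  | c + 3, _ =>
    have hc : (2 * (c + 3 : ℕ) : ℝ) + 1 ≤ 2 ^ (c + 3) := by
      clear * -
      induction c with
      | zero => norm_num
      | succ c ih =>
        rw [show c + 1 + 3 = c + 3 + 1 by ring, pow_succ]
        push_cast at ih ⊢
        have : (0 : ℝ) ≤ c := Nat.cast_nonneg c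
        linarith
    have h8 : (2 : ℝ) ≤ 2 ^ (c + 3) := by
      push_cast at hc
      have : (0 : ℝ) ≤ c := Nat.cast_nonneg c
      linarith
    have h1 : 1 + (q : ℝ) / 2 ≤ (3 / 2) ^ q := by linarith
    calc (2 * (c + 3 : ℕ) + q : ℝ) < 2 ^ (c + 3) + q := by linarith
      _ ≤ 2 ^ (c + 3) * (1 + q / 2) := by nlinarith
      _ ≤ _ := by gcongr

theorem two_mul_add_le_weight (c q : ℕ) : (2 * c + q : ℝ) ≤ 2 ^ c * (3 / 2) ^ q := by
  by_cases h : (c = 1 ∧ q ≤ 1) ∨ (c = 2 ∧ q = 0)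
  · rcases h with ⟨rfl, h⟩ | ⟨rfl, rfl⟩
    · interval_cases q <;> norm_num
    · norm_num
  · exact (two_mul_add_lt_weight h).le

/-- Here `e` is the excess of cycle incidences over three per cycle, `b` the number of inner bridges
and `i` the number of cycles missing. Each unit of `e + b` is worth at most 9/4, and `(9/4)^2 =
81/16 < 8`. -/
theorem two_pow_mul_lt {e b i ε : ℕ} (h : e + b = 2 * i + ε) (hne : ¬(e = 0 ∧ i = 0)) :
    (2 : ℝ) ^ e * (9 / 4) ^ b < 8 ^ i * (9 / 4) ^ ε := by
  have h1 : (2 : ℝ) ^ e * (9 / 4) ^ b ≤ (9 / 4) ^ e * (9 / 4) ^ b := by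
    gcongr; norm_num
  have h2 : ((9 / 4 : ℝ) ^ 2) ^ i * (9 / 4) ^ ε ≤ 8 ^ i * (9 / 4) ^ ε := by
    gcongr; norm_num
  have h3 : (9 / 4 : ℝ) ^ e * (9 / 4) ^ b = ((9 / 4 : ℝ) ^ 2) ^ i * (9 / 4) ^ ε := by
    rw [← pow_add, h, pow_add, pow_mul]
  by_cases he : e = 0
  · have hi : i ≠ 0 := fun hi => hne ⟨he, hi⟩
    have : ((9 / 4 : ℝ) ^ 2) ^ i * (9 / 4) ^ ε < 8 ^ i * (9 / 4) ^ ε := by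
      gcongr; norm_num
    linarith
  · have : (2 : ℝ) ^ e * (9 / 4) ^ b < (9 / 4) ^ e * (9 / 4) ^ b := by
      gcongr; norm_num
    linarith

theorem two_pow_mul_three_halves_pow_lt {A D r R ε : ℕ} (hA : 3 * r ≤ A)
    (h : 2 * A + D + 2 = 2 * (2 * R + 1 + ε) + 2 * r) (hε : ε ≤ 1)
    (hne : ¬(A = 3 * r ∧ D = 2 * ε)) :
    (2 : ℝ) ^ A * (3 / 2) ^ D < 8 ^ R * (9 / 4) ^ ε := by
  obtain ⟨e, rfl⟩ := Nat.exists_eq_add_of_le hA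
  obtain ⟨i, rfl⟩ := Nat.exists_eq_add_of_le (show r ≤ R by omega)
  obtain ⟨b, rfl⟩ : ∃ b, D = 2 * b := ⟨D / 2, by omega⟩
  have := two_pow_mul_lt (e := e) (b := b) (i := i) (ε := ε) (by omega) (by omega)
  have h8 : (2 : ℝ) ^ (3 * r) = 8 ^ r := by rw [pow_mul]; norm_num
  have h9 : (3 / 2 : ℝ) ^ (2 * b) = (9 / 4) ^ b := by rw [pow_mul]; norm_num
  rw [pow_add, pow_add, h8, h9, mul_assoc, mul_assoc]
  gcongr

theorem two_pow_mul_three_halves_pow_le {A D r R ε : ℕ} (hA : 3 * r ≤ A)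
    (h : 2 * A + D + 2 = 2 * (2 * R + 1 + ε) + 2 * r) (hε : ε ≤ 1) :
    (2 : ℝ) ^ A * (3 / 2) ^ D ≤ 8 ^ R * (9 / 4) ^ ε := by
  by_cases hne : A = 3 * r ∧ D = 2 * ε
  · obtain ⟨rfl, rfl⟩ := hne
    obtain rfl : R = r := by omega
    rw [pow_mul, pow_mul]
    norm_num
  · exact (two_pow_mul_three_halves_pow_lt hA h hε hne).le

end WeightBounds

/-! ### The upper bound, its equality case and the resulting structure -/

section Tight

variable {V : Type*} [Fintype V] {G : SimpleGraph V}

/-- The structure of the cacti whose degree product attains the upper bound: all cycles are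
triangles, every non-pendant vertex lies on one or two cycles and carries little else. -/
structure IsTight (G : SimpleGraph V) : Prop where
  sum_cycleCount : ∑ v, G.cycleCount v = 3 * #G.cycleFinset
  vertex : ∀ v, G.deg v ≠ 1 →
    (G.cycleCount v = 1 ∧ G.offDegree v ≤ 1) ∨ (G.cycleCount v = 2 ∧ G.offDegree v = 0)

theorem IsCactus.prod_nonpendants_le_weight (hG : G.IsCactus) (hV : 3 ≤ Fintype.card V) :
    ∏ v ∈ G.nonpendants, (G.deg v : ℝ) ≤ 2 ^ (∑ v, G.cycleCount v) *
      (3 / 2) ^ #G.innerOffPairs * (3 / 2) ^ {v | G.deg v = 1}.ncard := by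
  rw [mul_assoc, ← pow_add, add_comm, ← sum_nonpendants_offDegree hG.1 hV,
    ← sum_nonpendants_cycleCount, ← prod_pow_eq_pow_sum, ← prod_pow_eq_pow_sum,
    ← prod_mul_distrib]
  refine prod_le_prod (fun _ _ => Nat.cast_nonneg _) fun v _ => ?_
  rw [hG.deg_eq v]
  exact_mod_cast two_mul_add_le_weight _ _

theorem IsCactus.prod_nonpendants_lt_weight (hG : G.IsCactus) (hV : 3 ≤ Fintype.card V) {u : V}
    (hu : G.deg u ≠ 1) (h : ¬((G.cycleCount u = 1 ∧ G.offDegree u ≤ 1) ∨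
      (G.cycleCount u = 2 ∧ G.offDegree u = 0))) :
    ∏ v ∈ G.nonpendants, (G.deg v : ℝ) < 2 ^ (∑ v, G.cycleCount v) *
      (3 / 2) ^ #G.innerOffPairs * (3 / 2) ^ {v | G.deg v = 1}.ncard := by
  rw [mul_assoc, ← pow_add, add_comm, ← sum_nonpendants_offDegree hG.1 hV,
    ← sum_nonpendants_cycleCount, ← prod_pow_eq_pow_sum, ← prod_pow_eq_pow_sum,
    ← prod_mul_distrib]
  refine prod_lt_prod (fun v _ => ?_) (fun v _ => ?_) ⟨u, by simpa using hu, ?_⟩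
  · exact_mod_cast one_le_deg hG.1 (by omega) v
  · rw [hG.deg_eq v]
    exact_mod_cast two_mul_add_le_weight _ _
  · rw [hG.deg_eq u]
    exact_mod_cast two_mul_add_lt_weight h

theorem IsCactus.prod_nonpendants_le (hG : G.IsCactus) (hV : 3 ≤ Fintype.card V) {R ε : ℕ}
    (hN : #G.nonpendants = 2 * R + 1 + ε) (hε : ε ≤ 1) :
    ∏ v ∈ G.nonpendants, (G.deg v : ℝ) ≤
      8 ^ R * (9 / 4) ^ ε * (3 / 2) ^ {v | G.deg v = 1}.ncard := by
  refine (hG.prod_nonpendants_le_weight hV).trans ?_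
  gcongr ?_ * _
  refine two_pow_mul_three_halves_pow_le (three_mul_card_cycleFinset_le G) ?_ hε
  rw [hG.card_innerOffPairs_add hV, hN]

/-- Attaining the bound forces equality both in the global exchange and in the local estimate at
every non-pendant vertex. -/
theorem IsCactus.isTight_of_le (hG : G.IsCactus) (hV : 3 ≤ Fintype.card V) {R ε : ℕ}
    (hN : #G.nonpendants = 2 * R + 1 + ε) (hε : ε ≤ 1)
    (h : 8 ^ R * (9 / 4) ^ ε * (3 / 2) ^ {v | G.deg v = 1}.ncard ≤
      ∏ v ∈ G.nonpendants, (G.deg v : ℝ)) :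
    G.IsTight ∧ #G.cycleFinset = R ∧ #G.innerOffPairs = 2 * ε := by
  have hcount := hG.card_innerOffPairs_add hV
  rw [hN] at hcount
  have h3 := three_mul_card_cycleFinset_le G
  have key : ∑ v, G.cycleCount v = 3 * #G.cycleFinset ∧ #G.innerOffPairs = 2 * ε := by
    by_contra hne
    have := two_pow_mul_three_halves_pow_lt h3 hcount hε hne
    refine absurd (h.trans (hG.prod_nonpendants_le_weight hV)) (not_le.2 ?_)
    gcongr
  refine ⟨⟨key.1, fun v hv => ?_⟩, by omega, key.2⟩
  by_contra hne
  refine absurd (h.trans_lt (hG.prod_nonpendants_lt_weight hV hv hne)) (not_lt.2 ?_)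
  gcongr ?_ * _
  exact two_pow_mul_three_halves_pow_le h3 hcount hε

theorem IsTight.exists_cycle (h : G.IsTight) {v : V} (hv : G.deg v ≠ 1) :
    ∃ C ∈ G.cycleSubgraphs, v ∈ C.verts :=
  exists_cycle_of_cycleCount_pos (by have := h.vertex v hv; omega)

theorem IsTight.deg_eq (h : G.IsTight) (hG : G.IsCactus) {v : V} (hv : G.deg v ≠ 1) :
    G.deg v = 2 ∨ G.deg v = 3 ∨ G.deg v = 4 := by
  have := h.vertex v hv
  have := hG.deg_eq v
  omega

theorem IsTight.cyclesAreTriangles (h : G.IsTight) : G.CyclesAreTriangles := by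
  intro v p hp
  rw [← hp.ncard_verts, ncard_verts_of_sum_cycleCount_eq h.sum_cycleCount ⟨v, p, hp, rfl⟩]

/-- The neighbour `w` of a pendant vertex is not pendant, hence lies on a cycle; a dense path meets
a cycle only in `u`, so `w = u`. The permitted exception of length 2 therefore never occurs. -/
theorem IsTight.densePath_length (h : G.IsTight) (hG : G.IsCactus) (hV : 3 ≤ Fintype.card V)
    {u w : V} {p : G.Walk u w} {R : Set V} (hp : G.IsDensePath p R) : p.length = 0 := by
  obtain ⟨v, hv⟩ := hp.nonempty
  obtain ⟨hwv, hpath⟩ := hp.isPath v hv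
  obtain ⟨C, hC, hwC⟩ := h.exists_cycle (deg_ne_one_of_adj hG.1 hV hwv.symm (hp.pendant v hv))
  have hw : w ∈ densePathVerts p R ∩ C.verts := ⟨Or.inl p.end_mem_support, hwC⟩
  rw [hp.cycle_inter C hC ⟨w, hw⟩, Set.mem_singleton_iff] at hw
  subst hw
  have hp' : p.IsPath := by
    rw [Walk.concat_eq_append] at hpath
    exact hpath.of_append_left
  exact Walk.length_eq_zero_iff.2 (Walk.isPath_iff_nil.1 hp')

theorem IsTight.densePathsRestricted (h : G.IsTight) (hG : G.IsCactus)
    (hV : 3 ≤ Fintype.card V) : G.DensePathsRestricted := by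
  constructor
  · intro u w p R hp
    rw [h.densePath_length hG hV hp]
    norm_num
  · intro u w p R _ _ _ _ hp _ h1 _
    rw [h.densePath_length hG hV hp] at h1
    omega

/-- An interior vertex has degree at least 2 and so lies on a cycle, but the path meets cycles only
at its ends. -/
theorem ConnectsOnlyTwoCycles.length_le_one (hexc : ∀ v, G.deg v ≠ 1 →
    ∃ C ∈ G.cycleSubgraphs, v ∈ C.verts) {x y : V} {p : G.Walk x y}
    (hp : G.ConnectsOnlyTwoCycles p) : p.length ≤ 1 := by
  obtain ⟨hpath, C₁, -, C₂, -, -, h₁, h₂, h₃⟩ := hp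
  match p, hpath, h₁, h₂, h₃ with
  | .nil, _, _, _, _ => simp
  | .cons _ .nil, _, _, _, _ => simp
  | .cons (v := z) hxz (.cons (v := z') hzz' p), hpath, h₁, h₂, h₃ =>
    exfalso
    rw [Walk.cons_isPath_iff, Walk.cons_isPath_iff] at hpath
    obtain ⟨⟨-, hzp⟩, hx⟩ := hpath
    have hxz' : x ≠ z' := by
      rintro rfl
      exact hx (by simp)
    have hzmem : z ∈ {w | w ∈ (Walk.cons hxz (Walk.cons hzz' p)).support} := by simp
    have h2 := two_le_deg_of_adj_of_adj hxz.symm hzz' hxz'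
    obtain ⟨C, hC, hzC⟩ := hexc z (by omega)
    by_cases hC₁ : C = C₁
    · subst hC₁
      have : z ∈ ({x} : Set V) := h₁ ▸ ⟨hzmem, hzC⟩
      exact hxz.ne this.symm
    by_cases hC₂ : C = C₂
    · subst hC₂
      have : z ∈ ({y} : Set V) := h₂ ▸ ⟨hzmem, hzC⟩
      rw [Set.mem_singleton_iff] at this
      exact hzp (this ▸ p.end_mem_support)
    exact Set.disjoint_left.1 (h₃ C hC hC₁ hC₂) hzmem hzC

theorem ConnectsOnlyTwoCycles.mem_innerOffPairs {x y : V} {h : G.Adj x y}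
    (hp : G.ConnectsOnlyTwoCycles h.toWalk) : (x, y) ∈ G.innerOffPairs := by
  obtain ⟨-, C₁, hC₁, C₂, hC₂, -, h₁, h₂, h₃⟩ := hp
  have hx : x ∈ {w | w ∈ h.toWalk.support} := by simp
  have hy : y ∈ {w | w ∈ h.toWalk.support} := by simp
  have hx1 : x ∈ C₁.verts := (h₁.symm ▸ Set.mem_singleton x :
    x ∈ {w | w ∈ h.toWalk.support} ∩ C₁.verts).2
  have hy2 : y ∈ C₂.verts := (h₂.symm ▸ Set.mem_singleton y :
    y ∈ {w | w ∈ h.toWalk.support} ∩ C₂.verts).2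
  have hdx := two_le_deg_of_mem_cycle hC₁ hx1
  have hdy := two_le_deg_of_mem_cycle hC₂ hy2
  refine SimpleGraph.mem_innerOffPairs.2 ⟨⟨h, fun C hC hadj => ?_⟩, by omega, by omega⟩
  by_cases hCC₁ : C = C₁
  · subst hCC₁
    have : y ∈ ({x} : Set V) := h₁ ▸ ⟨hy, hadj.snd_mem⟩
    exact h.ne (Set.mem_singleton_iff.1 this).symm
  by_cases hCC₂ : C = C₂
  · subst hCC₂
    have : x ∈ ({y} : Set V) := h₂ ▸ ⟨hx, hadj.fst_mem⟩
    exact h.ne (Set.mem_singleton_iff.1 this)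
  exact Set.disjoint_left.1 (h₃ C hC hCC₁ hCC₂) hx hadj.fst_mem

/-- A connecting path of length one is an inner edge on no cycle and is counted in both orders, so
two ordered pairs leave room for one such edge. -/
theorem IsTight.connectingPathsRestricted (h : G.IsTight) (hD : #G.innerOffPairs ≤ 2) :
    G.ConnectingPathsRestricted := by
  classical
  have hle : ∀ {x y : V} {p : G.Walk x y}, G.ConnectsOnlyTwoCycles p → p.length ≤ 1 :=
    fun hp => hp.length_le_one fun v hv => h.exists_cycle hv
  refine ⟨fun x y p hp => hle hp, ?_⟩
  intro x y p x' y' p' hp hp' hl hl'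
  have hone := hle hp
  have hone' := hle hp'
  match p, p' with
  | .cons hxy .nil, .cons hxy' .nil =>
    have hm := hp.mem_innerOffPairs
    have hm' := hp'.mem_innerOffPairs
    obtain ⟨ho, hdx, hdy⟩ := SimpleGraph.mem_innerOffPairs.1 hm
    have hms : (y, x) ∈ G.innerOffPairs := SimpleGraph.mem_innerOffPairs.2 ⟨ho.symm, hdy, hdx⟩
    have hne : (x, y) ≠ (y, x) := fun h => hxy.ne (congrArg Prod.fst h)
    have hpair : ({(x, y), (y, x)} : Finset (V × V)) = G.innerOffPairs := by
      refine eq_of_subset_of_card_le ?_ (by rwa [card_pair hne])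
      intro e he
      rcases mem_insert.1 he with rfl | he
      · exact hm
      · rwa [mem_singleton.1 he]
    rw [← hpair] at hm'
    simp only [mem_insert, mem_singleton, Prod.mk.injEq] at hm'
    rcases hm' with ⟨rfl, rfl⟩ | ⟨rfl, rfl⟩
    · rfl
    · rw [Walk.toSubgraph_cons_nil_eq_subgraphOfAdj, Walk.toSubgraph_cons_nil_eq_subgraphOfAdj,
        ← subgraphOfAdj_symm]
  | .nil, _ => simp at hl
  | _, .nil => simp at hl'
  | .cons _ (.cons _ _), _ => simp at hone
  | _, .cons _ (.cons _ _) => simp at hone'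

end Tight

end SimpleGraph

namespace SimpleGraph

open Finset

/-! ### Invariance under isomorphism -/

section Iso

variable {V W : Type*} {G : SimpleGraph V} {H : SimpleGraph W}

theorem IsCactus.of_iso (hG : G.IsCactus) (e : G ≃g H) : H.IsCactus := by
  refine ⟨(Iso.connected_iff e).1 hG.1, fun C₁ h₁ C₂ h₂ hne => ?_⟩
  have hlift : ∀ C ∈ H.cycleSubgraphs, ∃ C₀ ∈ G.cycleSubgraphs, C₀.map e.toHom = C := by
    refine fun C hC => exists_map_eq_of_mem_cycleSubgraphs e.toHom e.injective hC fun a b h => ?_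
    exact ⟨e.symm a, e.symm b, e.apply_symm_apply a, e.apply_symm_apply b,
      e.symm.map_adj_iff.2 h.adj_sub⟩
  obtain ⟨D₁, hD₁, rfl⟩ := hlift C₁ h₁
  obtain ⟨D₂, hD₂, rfl⟩ := hlift C₂ h₂
  exact pairwise_subsingleton_of_map e.toHom e.injective hG hD₁ hD₂ hne

theorem Iso.deg_eq [Fintype V] [Fintype W] (e : G ≃g H) (v : V) : H.deg (e v) = G.deg v := by
  classical
  exact e.degree_eq v

theorem Iso.degSeq_eq [Fintype V] [Fintype W] (e : G ≃g H) : H.degSeq = G.degSeq := by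
  rw [degSeq, degSeq, ← univ_map_equiv_to_embedding e.toEquiv, map_val, Multiset.map_map]
  exact Multiset.map_congr rfl fun v _ => e.deg_eq v

end Iso

/-! ### Gluing a pendant edge or a triangle at a vertex -/

section Attach

variable {V : Type*} (G : SimpleGraph V) (x : V) (W : Type*)

/-- The graph obtained from `G` by adding the vertices `W`, joined to each other and to `x`. -/
def attach : SimpleGraph (V ⊕ W) where
  Adj
    | .inl u, .inl v => G.Adj u v
    | .inl u, .inr _ => u = x
    | .inr _, .inl v => v = x
    | .inr a, .inr b => a ≠ b
  symm := ⟨by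
    rintro (u | a) (v | b) h
    · exact Adj.symm h
    · exact h
    · exact h
    · exact Ne.symm h⟩
  loopless := ⟨by
    rintro (u | a) h
    · exact G.irrefl h
    · exact h rfl⟩

variable {G x W}

@[simp]
theorem attach_adj_inl_inl {u v : V} : (G.attach x W).Adj (.inl u) (.inl v) ↔ G.Adj u v := Iff.rfl

@[simp]
theorem attach_adj_inl_inr {u : V} {b : W} :
    (G.attach x W).Adj (.inl u) (.inr b) ↔ u = x := Iff.rfl

@[simp]
theorem attach_adj_inr_inl {a : W} {v : V} :
    (G.attach x W).Adj (.inr a) (.inl v) ↔ v = x := Iff.rfl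

@[simp]
theorem attach_adj_inr_inr {a b : W} :
    (G.attach x W).Adj (.inr a) (.inr b) ↔ a ≠ b := Iff.rfl

variable (x W) in
/-- The inclusion of `G` into `G.attach x W`. -/
def attachInl : G →g G.attach x W where
  toFun := Sum.inl
  map_rel' h := h

theorem connected_attach (hG : G.Connected) : (G.attach x W).Connected := by
  have key : ∀ y, (G.attach x W).Reachable (.inl x) y := by
    rintro (v | a)
    · exact (hG.preconnected x v).map (attachInl x W)
    · exact Adj.reachable (G := G.attach x W) (u := .inl x) (v := .inr a) rfl
  exact (connected_iff_exists_forall_reachable _).2 ⟨.inl x, key⟩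

theorem exists_map_of_mem_cycleSubgraphs_attach {C : (G.attach x W).Subgraph}
    (hC : C ∈ (G.attach x W).cycleSubgraphs) (h : ∀ a, Sum.inr a ∉ C.verts) :
    ∃ C₀ ∈ G.cycleSubgraphs, C₀.map (attachInl x W) = C := by
  refine exists_map_eq_of_mem_cycleSubgraphs _ Sum.inl_injective hC ?_
  rintro (u | a) (v | b) hadj
  · exact ⟨u, v, rfl, rfl, hadj.adj_sub⟩
  · exact (h b hadj.snd_mem).elim
  · exact (h a hadj.fst_mem).elim
  · exact (h a hadj.fst_mem).elim

theorem inter_subsingleton_attach {C D : (G.attach x W).Subgraph}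
    (hC : C = (⊤ : (G.attach x W).Subgraph).induce ({.inl x} ∪ Set.range Sum.inr))
    (hD : ∀ a, Sum.inr a ∉ D.verts) : (C.verts ∩ D.verts).Subsingleton := by
  have : C.verts ∩ D.verts ⊆ {.inl x} := by
    rintro y ⟨hy, hyD⟩
    rw [hC] at hy
    rcases hy with hy | ⟨a, rfl⟩
    · exact hy
    · exact (hD a hyD).elim
  exact Set.subsingleton_singleton.anti this

section Fintype

variable [Fintype V] [Fintype W]

theorem deg_attach_inl_self : (G.attach x W).deg (.inl x) = G.deg x + Fintype.card W := by
  classical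
  rw [deg_eq_card_filter, deg_eq_card_filter, card_filter, Fintype.sum_sum_type, card_filter]
  simp

theorem deg_attach_inl_of_ne {v : V} (hv : v ≠ x) : (G.attach x W).deg (.inl v) = G.deg v := by
  classical
  rw [deg_eq_card_filter, deg_eq_card_filter, card_filter, Fintype.sum_sum_type, card_filter]
  simp [hv]

theorem deg_attach_inr (a : W) : (G.attach x W).deg (.inr a) = Fintype.card W := by
  classical
  rw [deg_eq_card_filter, card_filter, Fintype.sum_sum_type, ← card_filter, ← card_filter]
  have h1 : #{v : V | (G.attach x W).Adj (.inr a) (.inl v)} = 1 := by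
    rw [card_eq_one]
    exact ⟨x, by ext; simp⟩
  have h2 : ({b : W | (G.attach x W).Adj (.inr a) (.inr b)} : Finset W) = univ.erase a := by
    ext b; simp [eq_comm]
  have h3 : 0 < Fintype.card W := Fintype.card_pos_iff.2 ⟨a⟩
  rw [h1, h2, card_erase_of_mem (mem_univ a), card_univ]
  omega

/-- The new vertices and `x` are pairwise adjacent, so each new vertex has degree `card W`: one
vertex is a pendant, two form a triangle with `x`. -/
theorem degSeq_attach {a : ℕ} {s : Multiset ℕ} (hx : G.deg x = a) (hs : G.degSeq = a ::ₘ s) :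
    (G.attach x W).degSeq =
      (a + Fintype.card W) ::ₘ (s + Multiset.replicate (Fintype.card W) (Fintype.card W)) := by
  classical
  have hs' : s = (univ.erase x).val.map G.deg := by
    rw [degSeq, ← insert_erase (mem_univ x), insert_val_of_notMem (notMem_erase x _),
      Multiset.map_cons, hx] at hs
    exact ((Multiset.cons_inj_right _).1 hs).symm
  have h1 : ((univ : Finset V).val.map fun v => (G.attach x W).deg (.inl v)) =
      (a + Fintype.card W) ::ₘ s := by
    rw [← insert_erase (mem_univ x), insert_val_of_notMem (notMem_erase x _),
      Multiset.map_cons, deg_attach_inl_self, hx, hs']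
    congr 1
    exact Multiset.map_congr rfl fun v hv => deg_attach_inl_of_ne (ne_of_mem_erase hv)
  have h2 : ((univ : Finset W).val.map fun b => (G.attach x W).deg (.inr b)) =
      Multiset.replicate (Fintype.card W) (Fintype.card W) := by
    simp_rw [deg_attach_inr, Multiset.map_const']
    rfl
  rw [degSeq, ← univ_disjSum_univ, val_disjSum, Multiset.disjSum, Multiset.map_add,
    Multiset.map_map, Multiset.map_map]
  exact (congrArg₂ _ h1 h2).trans (Multiset.cons_add _ _ _)

/-- A cycle uses both edges at a vertex of degree 2. Through a new vertex it must therefore contain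
all new vertices and use up its two edges at `x`, which closes it as the glued triangle. -/
theorem eq_induce_of_mem_cycleSubgraphs_attach (hW : Fintype.card W ≤ 2)
    {C : (G.attach x W).Subgraph} (hC : C ∈ (G.attach x W).cycleSubgraphs) {a : W}
    (ha : Sum.inr a ∈ C.verts) :
    C = (⊤ : (G.attach x W).Subgraph).induce ({.inl x} ∪ Set.range Sum.inr) := by
  classical
  have hnbr : ∀ b : W, Sum.inr b ∈ C.verts →
      2 ≤ Fintype.card W ∧ ∀ y, (G.attach x W).Adj (.inr b) y → C.Adj (.inr b) y := by
    intro b hb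
    have h2 := ncard_neighborSet_of_mem_cycleSubgraphs hC hb
    have hle : ((G.attach x W).neighborSet (.inr b)).ncard = Fintype.card W := by
      rw [← deg_attach_inr (G := G) (x := x) b, deg_eq_card_filter, ← Set.ncard_coe_finset]
      congr 1
      ext; simp
    have hsub := C.neighborSet_subset (.inr b)
    have h3 := Set.ncard_le_ncard hsub (Set.toFinite _)
    refine ⟨by omega, fun y hy => ?_⟩
    have := Set.eq_of_subset_of_ncard_le hsub (by omega) (Set.toFinite _)
    have hy' : y ∈ C.neighborSet (.inr b) := this ▸ hy
    exact hy'
  have hcard : Fintype.card W = 2 := le_antisymm hW (hnbr a ha).1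
  have hmem : ∀ b : W, Sum.inr b ∈ C.verts := by
    intro b
    by_cases hab : a = b
    · exact hab ▸ ha
    · exact ((hnbr a ha).2 (.inr b) hab).snd_mem
  have hx : ∀ b : W, C.Adj (.inl x) (.inr b) := fun b =>
    ((hnbr b (hmem b)).2 (.inl x) rfl).symm
  have hxnbr : C.neighborSet (.inl x) = Set.range Sum.inr := by
    symm
    refine Set.eq_of_subset_of_ncard_le ?_ ?_ (Set.toFinite _)
    · rintro _ ⟨b, rfl⟩
      exact hx b
    · rw [ncard_neighborSet_of_mem_cycleSubgraphs hC (hx a).fst_mem, ← Set.image_univ,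
        Set.ncard_image_of_injective _ Sum.inr_injective, Set.ncard_univ,
        Nat.card_eq_fintype_card, hcard]
  have hsub : C.verts ⊆ {.inl x} ∪ Set.range Sum.inr := by
    refine Subgraph.verts_subset_of_closed (connected_of_mem_cycleSubgraphs hC) ha
      (Or.inr ⟨a, rfl⟩) ?_
    rintro _ (rfl | ⟨b, rfl⟩) y hy
    · right
      rw [← hxnbr]
      exact hy
    · rcases y with v | c
      · left
        rw [Set.mem_singleton_iff, show v = x from hy.adj_sub]
      · exact Or.inr ⟨c, rfl⟩
  have hverts : C.verts = {.inl x} ∪ Set.range Sum.inr := by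
    refine hsub.antisymm ?_
    rintro _ (rfl | ⟨b, rfl⟩)
    · exact (hx a).fst_mem
    · exact hmem b
  refine Subgraph.ext hverts ?_
  ext y z
  simp only [Subgraph.induce_adj, Subgraph.top_adj]
  constructor
  · exact fun h => ⟨hsub h.fst_mem, hsub h.snd_mem, h.adj_sub⟩
  · rintro ⟨rfl | ⟨b, rfl⟩, hz, hadj⟩
    · rcases hz with rfl | ⟨c, rfl⟩
      · exact (hadj.ne rfl).elim
      · exact hx c
    · exact (hnbr b (hmem b)).2 z hadj

theorem IsCactus.attach (hG : G.IsCactus) (hW : Fintype.card W ≤ 2) :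
    (G.attach x W).IsCactus := by
  refine ⟨connected_attach hG.1, fun C hC D hD hne => ?_⟩
  by_cases h₁ : ∃ a, Sum.inr a ∈ C.verts <;> by_cases h₂ : ∃ a, Sum.inr a ∈ D.verts
  · obtain ⟨a, ha⟩ := h₁
    obtain ⟨b, hb⟩ := h₂
    exact (hne ((eq_induce_of_mem_cycleSubgraphs_attach hW hC ha).trans
      (eq_induce_of_mem_cycleSubgraphs_attach hW hD hb).symm)).elim
  · obtain ⟨a, ha⟩ := h₁
    exact inter_subsingleton_attach (eq_induce_of_mem_cycleSubgraphs_attach hW hC ha)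
      (not_exists.1 h₂)
  · obtain ⟨b, hb⟩ := h₂
    rw [Set.inter_comm]
    exact inter_subsingleton_attach (eq_induce_of_mem_cycleSubgraphs_attach hW hD hb)
      (not_exists.1 h₁)
  · obtain ⟨C₀, hC₀, rfl⟩ := exists_map_of_mem_cycleSubgraphs_attach hC (not_exists.1 h₁)
    obtain ⟨D₀, hD₀, rfl⟩ := exists_map_of_mem_cycleSubgraphs_attach hD (not_exists.1 h₂)
    exact pairwise_subsingleton_of_map _ Sum.inl_injective hG hC₀ hD₀ hne

end Fintype

end Attach

/-! ### Degree sequences realized by cacti -/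

section Realizable

/-- The multiset is the degree sequence of a cactus. -/
def CactusDegrees (s : Multiset ℕ) : Prop :=
  ∃ (V : Type) (_ : Fintype V) (G : SimpleGraph V), G.IsCactus ∧ G.degSeq = s

theorem cactusDegrees_zero : CactusDegrees {0} := by
  refine ⟨Unit, inferInstance, ⊥, ⟨Connected.mk fun _ _ => Reachable.refl _, ?_⟩, ?_⟩
  · exact fun _ _ _ _ _ => Set.subsingleton_of_subsingleton
  · classical
    simp [degSeq, deg]

theorem CactusDegrees.attach {a : ℕ} {s : Multiset ℕ} (h : CactusDegrees (a ::ₘ s)) {m : ℕ}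
    (hm : m ≤ 2) : CactusDegrees ((a + m) ::ₘ (s + Multiset.replicate m m)) := by
  obtain ⟨V, _, G, hG, hs⟩ := h
  obtain ⟨x, -, hx⟩ := Multiset.mem_map.1 (show a ∈ G.degSeq by rw [hs]; simp)
  refine ⟨V ⊕ Fin m, inferInstance, G.attach x (Fin m), hG.attach (by simpa), ?_⟩
  rw [degSeq_attach hx hs, Fintype.card_fin]

theorem CactusDegrees.exists_fin {s : Multiset ℕ} (h : CactusDegrees s) {n : ℕ}
    (hn : s.card = n) : ∃ G : SimpleGraph (Fin n), G.IsCactus ∧ G.degSeq = s := by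
  obtain ⟨V, _, G, hG, rfl⟩ := h
  have hV : Fintype.card V = n := by simpa [degSeq] using hn
  let e := Fintype.equivFinOfCardEq hV
  exact ⟨G.map e.toEmbedding, hG.of_iso (Iso.map e G), (Iso.map e G).degSeq_eq⟩

/-- A cycle uses all edges at its vertices, so by connectedness it is the whole graph; there are no
two distinct cycles. -/
theorem isCactus_of_deg_eq_two {V : Type*} [Fintype V] {G : SimpleGraph V} (hG : G.Connected)
    (h : ∀ v, G.deg v = 2) : G.IsCactus := by
  classical
  refine ⟨hG, fun C hC D hD hne => (hne ?_).elim⟩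
  have key : ∀ C ∈ G.cycleSubgraphs, C = ⊤ := by
    intro C hC
    have hadj : ∀ a ∈ C.verts, ∀ b, G.Adj a b → C.Adj a b := by
      intro a ha b hab
      have hle : (G.neighborSet a).ncard = 2 := by
        rw [← h a, deg_eq_card_filter, ← Set.ncard_coe_finset]
        congr 1
        ext; simp
      have := Set.eq_of_subset_of_ncard_le (C.neighborSet_subset a)
        (by rw [hle, ncard_neighborSet_of_mem_cycleSubgraphs hC ha]) (Set.toFinite _)
      have hb : b ∈ C.neighborSet a := this ▸ hab
      exact hb
    obtain ⟨v, hv⟩ := (connected_of_mem_cycleSubgraphs hC).nonempty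
    have huniv : C.verts = Set.univ :=
      hG.eq_univ_of_closed hv fun a ha b hab => (hadj a ha b hab).snd_mem
    refine Subgraph.ext huniv ?_
    ext a b
    exact ⟨fun h => h.adj_sub, fun h => hadj a (huniv ▸ Set.mem_univ a) b h⟩
  rw [key C hC, key D hD]

theorem cactusDegrees_four_two : CactusDegrees (Multiset.replicate 4 2) := by
  classical
  have hdeg : ∀ v, (cycleGraph 4).deg v = 2 := by
    intro v
    rw [deg]
    convert cycleGraph_degree_three_le (n := 1) (v := v)
  refine ⟨Fin 4, inferInstance, cycleGraph 4,
    isCactus_of_deg_eq_two cycleGraph_connected hdeg, ?_⟩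
  simp_rw [degSeq, hdeg, Multiset.map_const']
  rfl

end Realizable

end SimpleGraph

namespace SimpleGraph

/-! ### The extremal families -/

section Families

open Multiset

/-- One pendant vertex is hung on each of `j` vertices of degree 2; the induction moves the finished
vertices into `s`. -/
theorem CactusDegrees.raise {j : ℕ} {s : Multiset ℕ} (h : CactusDegrees (replicate j 2 + s)) :
    CactusDegrees (replicate j 3 + replicate j 1 + s) := by
  induction j generalizing s with
  | zero => simpa using h
  | succ j ih =>
    rw [replicate_succ, Multiset.cons_add] at h
    have h1 := h.attach (m := 1) (by norm_num)
    have h2 := ih (s := 3 ::ₘ 1 ::ₘ s) (by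
      convert h1 using 1
      simp only [← singleton_add, replicate_one, Nat.reduceAdd]
      abel)
    convert h2 using 1
    simp only [replicate_succ, ← singleton_add]
    abel

/-- The start is a triangle for `ε = 0` and two triangles joined by an edge for `ε = 1`. Each
further triangle is glued at a vertex of degree 2. -/
theorem cactusDegrees_family_base (m : ℕ) {ε : ℕ} (hε : ε ≤ 1) :
    CactusDegrees (replicate m 4 + replicate (2 * ε) 3 + replicate (m + 3 + ε) 2) := by
  induction m with
  | zero =>
    have h1 : CactusDegrees (2 ::ₘ replicate 2 2) := by
      simpa using CactusDegrees.attach (a := 0) (s := 0) cactusDegrees_zero (m := 2) le_rfl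
    interval_cases ε
    · exact h1
    · have h2 : CactusDegrees (1 ::ₘ {3, 2, 2}) := by
        convert h1.attach (m := 1) (by norm_num) using 1
        decide
      exact h2.attach (m := 2) le_rfl
  | succ m ih =>
    have h1 : CactusDegrees (2 ::ₘ (replicate m 4 + replicate (2 * ε) 3 +
        replicate (m + 2 + ε) 2)) := by
      convert ih using 1
      rw [show m + 3 + ε = m + 2 + ε + 1 by ring, replicate_succ _ (m + 2 + ε), add_cons]
    convert h1.attach (m := 2) le_rfl using 1
    rw [show m + 1 + 3 + ε = m + 2 + ε + 2 by ring, replicate_add (m + 2 + ε), replicate_succ]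
    simp only [← singleton_add, Nat.reduceAdd]
    abel

theorem cactusDegrees_family {m ε k j : ℕ} (hε : ε ≤ 1) (hj : k + j = m + 3 + ε) :
    CactusDegrees (replicate m 4 + replicate (k + 2 * ε) 3 + replicate j 2 + replicate k 1) := by
  have h1 := cactusDegrees_family_base m hε
  rw [← hj, replicate_add] at h1
  have h2 : CactusDegrees (replicate k 2 + (replicate m 4 + replicate (2 * ε) 3 +
      replicate j 2)) := by
    convert h1 using 1
    abel
  convert h2.raise using 1
  rw [replicate_add]
  abel

theorem prod_family {m ε k j : ℕ} (hj : k + j = m + 3 + ε) :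
    ((replicate m 4 + replicate (k + 2 * ε) 3 + replicate j 2 + replicate k 1).map
      (Nat.cast : ℕ → ℝ)).prod = 8 ^ (m + 1 + ε) * (9 / 4) ^ ε * (3 / 2) ^ k := by
  have h1 : (2 : ℝ) ^ k * 2 ^ j = 2 ^ m * 8 * 2 ^ ε := by
    rw [← pow_add, hj, pow_add, pow_add]
    norm_num
  have h4 : (8 : ℝ) ^ m = 4 ^ m * 2 ^ m := by rw [← mul_pow]; norm_num
  have h3 : (3 : ℝ) ^ k = (3 / 2) ^ k * 2 ^ k := by rw [← mul_pow]; norm_num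
  simp only [Multiset.map_add, map_replicate, prod_add, prod_replicate, Nat.cast_one, one_pow,
    mul_one, Nat.cast_ofNat]
  rw [pow_add (3 : ℝ), h3, pow_add (8 : ℝ), pow_add (8 : ℝ), h4]
  have h5 : (3 : ℝ) ^ (2 * ε) * 2 ^ ε = 8 ^ ε * (9 / 4) ^ ε := by
    rw [pow_mul, ← mul_pow, ← mul_pow]; norm_num
  calc (4 : ℝ) ^ m * ((3 / 2) ^ k * 2 ^ k * 3 ^ (2 * ε)) * 2 ^ j
      = 4 ^ m * (3 / 2) ^ k * 3 ^ (2 * ε) * (2 ^ k * 2 ^ j) := by ring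
    _ = 4 ^ m * (3 / 2) ^ k * (3 ^ (2 * ε) * 2 ^ ε) * 2 ^ m * 8 := by rw [h1]; ring
    _ = _ := by rw [h5]; ring

/-- There is a cactus with `k` pendant vertices and `N` non-pendant ones, whose degrees have the
sum `S` and differ by at most one. -/
def BalancedCactus (N S k : ℕ) : Prop :=
  ∃ (m : ℕ) (s : Multiset ℕ), 2 ≤ m ∧ s.card = N ∧ s.sum = S ∧ (∀ d ∈ s, d = m ∨ d = m + 1) ∧
    CactusDegrees (s + replicate k 1)

/-- The new pendant vertex is hung on a non-pendant vertex of smallest degree. If none of degree `m`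
is left, `m + 1` becomes the new lower value. -/
theorem BalancedCactus.succ {N S k : ℕ} (hN : 0 < N) (h : BalancedCactus N S k) :
    BalancedCactus N (S + 1) (k + 1) := by
  obtain ⟨m, s, hm, hs, hS, hd, hc⟩ := h
  have key : ∀ a t, s = a ::ₘ t → card ((a + 1) ::ₘ t) = N ∧ ((a + 1) ::ₘ t).sum = S + 1 ∧
      CactusDegrees ((a + 1) ::ₘ t + replicate (k + 1) 1) := by
    rintro a t rfl
    refine ⟨by simpa using hs, ?_, ?_⟩
    · rw [← hS, sum_cons, sum_cons]; ring
    · rw [Multiset.cons_add] at hc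
      convert hc.attach (m := 1) (by norm_num) using 1
      rw [replicate_add, Multiset.cons_add, add_assoc]
  by_cases hms : m ∈ s
  · obtain ⟨t, rfl⟩ := exists_cons_of_mem hms
    obtain ⟨h1, h2, h3⟩ := key m t rfl
    refine ⟨m, _, hm, h1, h2, fun d hdt => ?_, h3⟩
    rcases mem_cons.1 hdt with rfl | hdt
    · exact Or.inr rfl
    · exact hd d (mem_cons_of_mem hdt)
  · have hd' : ∀ d ∈ s, d = m + 1 := fun d hds => (hd d hds).resolve_left fun h => hms (h ▸ hds)
    obtain ⟨a, ha⟩ := card_pos_iff_exists_mem.1 (hs ▸ hN)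
    obtain rfl := hd' a ha
    obtain ⟨t, rfl⟩ := exists_cons_of_mem ha
    obtain ⟨h1, h2, h3⟩ := key (m + 1) t rfl
    refine ⟨m + 1, _, by omega, h1, h2, fun d hdt => ?_, h3⟩
    rcases mem_cons.1 hdt with rfl | hdt
    · exact Or.inr rfl
    · exact Or.inl (hd' d (mem_cons_of_mem hdt))

theorem BalancedCactus.add {N S k : ℕ} (hN : 0 < N) (h : BalancedCactus N S k) (i : ℕ) :
    BalancedCactus N (S + i) (k + i) := by
  induction i with
  | zero => exact h
  | succ i ih => exact ih.succ hN

/-- At `k = m + 3 + ε` the family has lost all its vertices of degree 2 and has only degrees 3 and 4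
left besides the pendants. The sum is `2N + 2R - 2 + k` with `R = m + 1 + ε`, the largest possible.
-/
theorem balancedCactus_of_le {m ε k : ℕ} (hε : ε ≤ 1) (hk : m + 3 + ε ≤ k) :
    BalancedCactus (2 * m + 3 + 3 * ε) (6 * m + 6 + 8 * ε + k) k := by
  obtain ⟨i, rfl⟩ := Nat.exists_eq_add_of_le hk
  have h : BalancedCactus (2 * m + 3 + 3 * ε) (6 * m + 6 + 8 * ε + (m + 3 + ε)) (m + 3 + ε) := by
    refine ⟨3, replicate m 4 + replicate (m + 3 + ε + 2 * ε) 3, by norm_num, ?_, ?_, ?_, ?_⟩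
    · simp; ring
    · simp; ring
    · intro d hd
      rcases mem_add.1 hd with hd | hd <;> simp [eq_of_mem_replicate hd]
    · simpa using cactusDegrees_family (m := m) (k := m + 3 + ε) (j := 0) hε rfl
  exact add_assoc _ (m + 3 + ε) i ▸ h.add (by omega) i

theorem balancedCactus_four {k : ℕ} (hk : 1 ≤ k) : BalancedCactus 4 (8 + k) k := by
  obtain ⟨i, rfl⟩ := Nat.exists_eq_add_of_le hk
  have h : BalancedCactus 4 (8 + 1) 1 := by
    refine ⟨2, {3, 2, 2, 2}, le_rfl, rfl, rfl, ?_, ?_⟩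
    · simp
    -- The witness is a triangle with a path of length two hanging from it.
    · have h1 : CactusDegrees (1 ::ₘ {3, 2, 2}) := by
        convert cactusDegrees_family (m := 0) (ε := 0) (k := 1) (j := 2) (by norm_num) rfl using 1
        decide
      convert h1.attach (m := 1) (by norm_num) using 1
      decide
  exact add_assoc 8 1 i ▸ h.add (by norm_num) i

end Families

/-! ### Log-concavity of the degree as an exponential bound -/

section Balanced

/-- The exponential `m ((m + 1)/m)^(d - m)` agrees with `d` at `m` and `m + 1`, and by concavity of
the logarithm lies above it at all other integers. Above `m` this is Bernoulli's inequality. -/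
theorem mul_pow_le_mul_pow {m : ℕ} (hm : 1 ≤ m) (d : ℕ) :
    (d : ℝ) * ((m + 1) / m) ^ m ≤ m * ((m + 1) / m) ^ d ∧ (d ≠ m → d ≠ m + 1 →
      (d : ℝ) * ((m + 1) / m) ^ m < m * ((m + 1) / m) ^ d) := by
  have hm0 : (0 : ℝ) < m := by exact_mod_cast hm
  set x : ℝ := (m + 1) / m with hx
  have hx0 : 0 < x := by positivity
  have hmx : m * x = m + 1 := by rw [hx]; field_simp
  have hdown : ∀ j d : ℕ, d + j = m → (d : ℝ) * x ^ m ≤ m * x ^ d ∧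
      (d ≠ m → (d : ℝ) * x ^ m < m * x ^ d) := by
    intro j
    induction j with
    | zero =>
      rintro d rfl
      exact ⟨le_rfl, fun h => (h rfl).elim⟩
    | succ j ih =>
      intro d hd
      have h1 := (ih (d + 1) (by omega)).1
      have hdm : (d : ℝ) + 1 ≤ m := by exact_mod_cast (by omega : d + 1 ≤ m)
      have : (d : ℝ) * x ^ m < m * x ^ d := by
        have h2 : m * x ^ (d + 1) = (m + 1) * x ^ d := by rw [pow_succ, ← hmx]; ring
        rw [h2] at h1
        push_cast at h1
        have hxm : 0 < x ^ m := by positivity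
        -- Strictness comes from `(m + 1) * d < m * (d + 1)`, that is, from `d < m`.
        have h3 : (m + 1) * (d * x ^ m) < (m + 1) * (m * x ^ d) := by
          nlinarith [mul_le_mul_of_nonneg_left h1 hm0.le]
        exact lt_of_mul_lt_mul_left h3 (by positivity)
      exact ⟨this.le, fun _ => this⟩
  have hup : ∀ j : ℕ, ((m + j : ℕ) : ℝ) * x ^ m ≤ m * x ^ (m + j) ∧
      (2 ≤ j → ((m + j : ℕ) : ℝ) * x ^ m < m * x ^ (m + j)) := by
    intro j
    have hx1 : x = 1 + 1 / m := by rw [hx]; field_simp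
    have hxm : 0 < x ^ m := by positivity
    have hB : ((m + j : ℕ) : ℝ) = m * (1 + j * (1 / m)) := by
      push_cast; field_simp
    have hpow : (m : ℝ) * x ^ (m + j) = m * (1 + 1 / m) ^ j * x ^ m := by
      rw [pow_add, ← hx1]; ring
    have hm1 : (0 : ℝ) < 1 / m := by positivity
    rw [hB, hpow]
    constructor
    · gcongr
      exact one_add_mul_le_pow (by linarith) j
    · intro hj
      gcongr
      have := one_add_mul_self_lt_rpow_one_add (s := (1 / m : ℝ)) (by linarith) hm1.ne'
        (p := j) (by exact_mod_cast hj)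
      rwa [Real.rpow_natCast] at this
  rcases le_total d m with h | h
  · obtain ⟨j, hj⟩ := Nat.exists_eq_add_of_le h
    obtain ⟨h1, h2⟩ := hdown j d hj.symm
    exact ⟨h1, fun h _ => h2 h⟩
  · obtain ⟨j, rfl⟩ := Nat.exists_eq_add_of_le h
    obtain ⟨h1, h2⟩ := hup j
    exact ⟨h1, fun h3 h4 => h2 (by omega)⟩

end Balanced

end SimpleGraph

namespace SimpleGraph

open Finset

/-! ### Products of degrees: the tight sequence and the balanced comparison -/

section DegreeProduct

variable {V : Type*} [Fintype V] {G : SimpleGraph V}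

/-- The product of the degrees. -/
noncomputable def degProd (G : SimpleGraph V) : ℝ := ∏ v, (G.deg v : ℝ)

theorem degProd_nonneg (G : SimpleGraph V) : 0 ≤ G.degProd :=
  prod_nonneg fun _ _ => Nat.cast_nonneg _

theorem zagrebProd_eq (c : ℝ) (G : SimpleGraph V) : G.zagrebProd c = G.degProd ^ c :=
  Real.finsetProd_rpow _ _ (fun _ _ => Nat.cast_nonneg _) c

theorem zagrebProd_le_iff {c : ℝ} (hc : 0 < c) {W : Type*} [Fintype W] {H : SimpleGraph W} :
    H.zagrebProd c ≤ G.zagrebProd c ↔ H.degProd ≤ G.degProd := by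
  rw [zagrebProd_eq, zagrebProd_eq, Real.rpow_le_rpow_iff H.degProd_nonneg G.degProd_nonneg hc]

theorem degProd_eq_prod_degSeq (G : SimpleGraph V) :
    G.degProd = (G.degSeq.map (Nat.cast : ℕ → ℝ)).prod := by
  rw [degSeq, Multiset.map_map]
  rfl

theorem degProd_eq_prod_nonpendants (G : SimpleGraph V) :
    G.degProd = ∏ v ∈ G.nonpendants, (G.deg v : ℝ) := by
  symm
  refine prod_subset (subset_univ _) fun v _ hv => ?_
  rw [mem_nonpendants, not_not] at hv
  rw [hv, Nat.cast_one]

theorem count_degSeq (G : SimpleGraph V) (d : ℕ) :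
    G.degSeq.count d = {v | G.deg v = d}.ncard := by
  classical
  have : {v | G.deg v = d} = ((univ.filter fun v => d = G.deg v : Finset V) : Set V) := by
    ext; simp [eq_comm]
  rw [this, Set.ncard_coe_finset, degSeq, Multiset.count_map]
  rfl

theorem IsCactus.sum_nonpendants_deg (hG : G.IsCactus) :
    ∑ v ∈ G.nonpendants, G.deg v + 2 =
      2 * #G.nonpendants + 2 * #G.cycleFinset + {v | G.deg v = 1}.ncard := by
  have h1 := hG.sum_deg_add_two
  have h2 := sum_deg_eq G
  have h3 := card_nonpendants_add G
  omega

theorem IsCactus.two_mul_card_cycleFinset_lt (hG : G.IsCactus) (hV : 3 ≤ Fintype.card V) :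
    2 * #G.cycleFinset < #G.nonpendants := by
  have h1 := hG.card_innerOffPairs_add hV
  have h2 := three_mul_card_cycleFinset_le G
  omega

theorem IsTight.degSeq_eq (h : G.IsTight) (hG : G.IsCactus) (hV : 3 ≤ Fintype.card V)
    (hk : {v | G.deg v = 1}.ncard = 0) {m ε : ℕ} (hn : Fintype.card V = 2 * m + 3 + 3 * ε)
    (hr : #G.cycleFinset = m + 1 + ε) (hD : #G.innerOffPairs = 2 * ε) :
    G.degSeq = Multiset.replicate m 4 + Multiset.replicate (2 * ε) 3 +
      Multiset.replicate (m + 3 + ε) 2 := by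
  classical
  have hnp : ∀ v, G.deg v ≠ 1 := by
    intro v hv
    have : v ∈ {v | G.deg v = 1} := hv
    rw [Set.ncard_eq_zero (Set.toFinite _)] at hk
    simp [hk] at this
  have huniv : G.nonpendants = univ := by
    ext v; simp [hnp v]
  have hcount : ∀ d, #{v | G.deg v = d} = G.degSeq.count d := by
    intro d
    rw [count_degSeq, ← Set.ncard_coe_finset]
    congr 1
    ext; simp
  -- Summing these identities gives three linear equations for the numbers of vertices of degree 2,
  -- 3 and 4.
  have hpt : ∀ v, G.cycleCount v = (if G.deg v = 2 then 1 else 0) +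
      (if G.deg v = 3 then 1 else 0) + 2 * (if G.deg v = 4 then 1 else 0) ∧
      G.offDegree v = (if G.deg v = 3 then 1 else 0) ∧
      1 = (if G.deg v = 2 then 1 else 0) +
      (if G.deg v = 3 then 1 else 0) + (if G.deg v = 4 then 1 else 0) := by
    intro v
    have h1 := h.vertex v (hnp v)
    have h2 := hG.deg_eq v
    split_ifs <;> omega
  have hA := h.sum_cycleCount
  rw [sum_congr rfl fun v _ => (hpt v).1, sum_add_distrib, sum_add_distrib, ← mul_sum,
    ← card_filter, ← card_filter, ← card_filter, hcount, hcount, hcount] at hA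
  have hQ := sum_nonpendants_offDegree hG.1 hV
  rw [huniv, sum_congr rfl fun v _ => (hpt v).2.1, ← card_filter, hcount, hk, hD] at hQ
  have hN : Fintype.card V = ∑ _v : V, 1 := by simp
  rw [sum_congr rfl fun v _ => (hpt v).2.2, sum_add_distrib, sum_add_distrib,
    ← card_filter, ← card_filter, ← card_filter, hcount, hcount, hcount] at hN
  have h4 : G.degSeq.count 4 = m := by omega
  have h3 : G.degSeq.count 3 = 2 * ε := by omega
  have h2 : G.degSeq.count 2 = m + 3 + ε := by omega
  ext d
  simp only [Multiset.count_add, Multiset.count_replicate]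
  by_cases hd : d = 2 ∨ d = 3 ∨ d = 4
  · rcases hd with rfl | rfl | rfl <;> simp [h2, h3, h4]
  · push Not at hd
    rw [if_neg hd.2.2.symm, if_neg hd.2.1.symm, if_neg hd.1.symm, ← hcount, card_eq_zero,
      filter_eq_empty_iff]
    intro v _ hv
    have := h.deg_eq hG (hnp v)
    omega

/-- A cactus whose non-pendant degrees differ by at most one beats all others with the same numbers
of pendant and non-pendant vertices, if the sum of its degrees is the largest. -/
theorem prod_lt_prod_of_balanced {m : ℕ} (hm : 1 ≤ m) {s : Multiset ℕ}
    (hs : ∀ d ∈ s, d = m ∨ d = m + 1) (hpos : ∀ v, 1 ≤ G.deg v) (hcard : s.card = #G.nonpendants)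
    (hsum : ∑ v ∈ G.nonpendants, G.deg v ≤ s.sum) (hG : ¬ G.NonpendantBalanced) :
    ∏ v ∈ G.nonpendants, (G.deg v : ℝ) < (s.map (Nat.cast : ℕ → ℝ)).prod := by
  have hm0 : (0 : ℝ) < m := by exact_mod_cast hm
  set x : ℝ := (m + 1) / m with hx
  have hx0 : 0 < x := by positivity
  have hx1 : 1 ≤ x := by rw [hx, one_le_div hm0]; linarith
  have hxm : 0 < x ^ m := by positivity
  -- Every entry of `s` is an interpolation point, so the exponential bound is exact on `s`.
  have hs' : (s.map (Nat.cast : ℕ → ℝ)).prod * (x ^ m) ^ s.card = m ^ s.card * x ^ s.sum := by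
    clear hcard hsum
    induction s using Multiset.induction with
    | empty => simp
    | cons d s ih =>
      have hd : (d : ℝ) * x ^ m = m * x ^ d := by
        rcases hs d (by simp) with rfl | rfl
        · rfl
        · rw [pow_succ]
          have : m * x = m + 1 := by rw [hx]; field_simp
          push_cast
          rw [← this]; ring
      have ih' := ih fun e he => hs e (Multiset.mem_cons_of_mem he)
      rw [Multiset.map_cons, Multiset.prod_cons, Multiset.card_cons, Multiset.sum_cons, pow_succ,
        pow_succ, pow_add]
      linear_combination ((s.map (Nat.cast : ℕ → ℝ)).prod * (x ^ m) ^ s.card) * hd +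
        (m * x ^ d) * ih'
  obtain ⟨u, hu1, hu⟩ : ∃ u, G.deg u ≠ 1 ∧ G.deg u ≠ m ∧ G.deg u ≠ m + 1 := by
    by_contra hno
    push Not at hno
    refine hG fun u v hu hv => ?_
    have h1 : G.deg u = m ∨ G.deg u = m + 1 := or_iff_not_imp_left.2 (hno u hu)
    have h2 : G.deg v = m ∨ G.deg v = m + 1 := or_iff_not_imp_left.2 (hno v hv)
    rw [abs_le]
    omega
  have hlt : (∏ v ∈ G.nonpendants, (G.deg v : ℝ)) * (x ^ m) ^ s.card <
      m ^ s.card * x ^ s.sum := by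
    calc (∏ v ∈ G.nonpendants, (G.deg v : ℝ)) * (x ^ m) ^ s.card
        = ∏ v ∈ G.nonpendants, (G.deg v : ℝ) * x ^ m := by
          rw [hcard, prod_mul_distrib, prod_const]
      _ < ∏ v ∈ G.nonpendants, (m : ℝ) * x ^ G.deg v := by
          refine prod_lt_prod (fun v _ => ?_) (fun v _ => (mul_pow_le_mul_pow hm _).1)
            ⟨u, by simpa using hu1, (mul_pow_le_mul_pow hm _).2 hu.1 hu.2⟩
          have : (1 : ℝ) ≤ G.deg v := by exact_mod_cast hpos v
          positivity
      _ = m ^ s.card * x ^ ∑ v ∈ G.nonpendants, G.deg v := by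
          rw [prod_mul_distrib, prod_const, prod_pow_eq_pow_sum, hcard]
      -- As `x ≥ 1`, a smaller degree sum only weakens the competitor.
      _ ≤ m ^ s.card * x ^ s.sum := by gcongr
  rw [← hs'] at hlt
  exact lt_of_mul_lt_mul_right hlt (by positivity)

end DegreeProduct

/-! ### Extremal cacti -/

section Extremal

theorem exists_mem_cacti {s : Multiset ℕ} (h : CactusDegrees s) {n k : ℕ} (hn : s.card = n)
    (hk : s.count 1 = k) : ∃ H ∈ cacti n k, H.degSeq = s := by
  obtain ⟨H, hH, rfl⟩ := h.exists_fin hn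
  exact ⟨H, ⟨hH, by rw [← hk, count_degSeq]⟩, rfl⟩

theorem card_nonpendants_of_mem_cacti {n k : ℕ} {G : SimpleGraph (Fin n)} (hG : G ∈ cacti n k) :
    #G.nonpendants + k = n := by
  have := card_nonpendants_add G
  rwa [hG.2, Fintype.card_fin] at this

theorem nonpendantBalanced_of_balancedCactus {n k S : ℕ} {G : SimpleGraph (Fin n)}
    (hG : G ∈ cacti n k) (hn : k + 3 ≤ n) (hb : BalancedCactus (n - k) S k)
    (hS : ∑ v ∈ G.nonpendants, G.deg v ≤ S)
    (hmax : ∀ H ∈ cacti n k, H.degProd ≤ G.degProd) : G.NonpendantBalanced := by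
  obtain ⟨m, s, hm, hs, rfl, hd, hc⟩ := hb
  have hN := card_nonpendants_of_mem_cacti hG
  by_contra hbal
  have h1 : 1 ∉ s := fun h => by
    have := hd 1 h
    omega
  obtain ⟨H, hH, hHs⟩ := exists_mem_cacti hc (n := n) (k := k) (by simp [hs]; omega)
    (by simp [Multiset.count_eq_zero_of_notMem h1])
  have hlt := prod_lt_prod_of_balanced (by omega) hd
    (one_le_deg hG.1.1 (by rw [Fintype.card_fin]; omega)) (by omega) hS hbal
  refine absurd (hmax H hH) (not_le.2 ?_)
  rw [degProd_eq_prod_nonpendants, degProd_eq_prod_degSeq, hHs]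
  simpa using hlt

/-- The degree sum grows with the number of cycles, which is at most `R` because twice that number
is less than the number of non-pendant vertices. -/
theorem sum_nonpendants_deg_le {n k R ε : ℕ} {G : SimpleGraph (Fin n)} (hG : G ∈ cacti n k)
    (hn : n = k + (2 * R + 1 + ε)) (hε : ε ≤ 1) (hR : 1 ≤ R) :
    ∑ v ∈ G.nonpendants, G.deg v + 2 ≤ 2 * (2 * R + 1 + ε) + 2 * R + k := by
  have hN := card_nonpendants_of_mem_cacti hG
  have h1 := hG.1.sum_nonpendants_deg
  have h2 := hG.1.two_mul_card_cycleFinset_lt (by rw [Fintype.card_fin]; omega)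
  rw [hG.2] at h1
  omega

theorem isTight_of_isMax {n k m ε : ℕ} {G : SimpleGraph (Fin n)} (hG : G ∈ cacti n k)
    (hn : n = k + (2 * m + 3 + 3 * ε)) (hε : ε ≤ 1) (hk : k ≤ m + 3 + ε)
    (hmax : ∀ H ∈ cacti n k, H.degProd ≤ G.degProd) :
    G.IsTight ∧ #G.innerOffPairs = 2 * ε := by
  have hN := card_nonpendants_of_mem_cacti hG
  obtain ⟨j, hj⟩ := Nat.exists_eq_add_of_le hk
  obtain ⟨H, hH, hHs⟩ := exists_mem_cacti (cactusDegrees_family hε hj.symm) (n := n) (k := k)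
    (by simp; omega) (by simp [Multiset.count_replicate])
  have hle := hmax H hH
  rw [degProd_eq_prod_degSeq, hHs, prod_family hj.symm, degProd_eq_prod_nonpendants] at hle
  obtain ⟨h1, -, h2⟩ := hG.1.isTight_of_le (R := m + 1 + ε) (ε := ε)
    (by rw [Fintype.card_fin]; omega) (by omega) hε (by rwa [hG.2])
  exact ⟨h1, h2⟩

/-- A cactus with the largest degree product, among those with given numbers of vertices and of
pendant vertices, is balanced or tight. -/
theorem nonpendantBalanced_or_isTight {n k : ℕ} (hk : k ≠ 0) (hn : k + 4 ≤ n)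
    {G : SimpleGraph (Fin n)} (hG : G ∈ cacti n k)
    (hmax : ∀ H ∈ cacti n k, H.degProd ≤ G.degProd) :
    G.NonpendantBalanced ∨ G.IsTight ∧ #G.innerOffPairs ≤ 2 := by
  by_cases h4 : n = k + 4
  -- Four non-pendant vertices would need `m = -1`: a single triangle cannot cover them all, so the
  -- tight bound is not attained.
  · left
    have hS := sum_nonpendants_deg_le (R := 1) (ε := 1) hG h4 le_rfl le_rfl
    refine nonpendantBalanced_of_balancedCactus (S := 8 + k) hG (by omega) ?_ (by omega) hmax
    rw [show n - k = 4 by omega]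
    exact balancedCactus_four (by omega)
  · obtain ⟨m, ε, hε, hm⟩ : ∃ m ε, ε ≤ 1 ∧ n = k + (2 * m + 3 + 3 * ε) := by
      rcases Nat.even_or_odd' (n - k) with ⟨i, hi | hi⟩
      -- An even number of non-pendant vertices is now at least 6, so the subtraction is not
      -- truncated.
      · exact ⟨i - 3, 1, le_rfl, by omega⟩
      · exact ⟨i - 1, 0, by norm_num, by omega⟩
    by_cases hkm : k ≤ m + 3 + ε
    · right
      obtain ⟨h1, h2⟩ := isTight_of_isMax hG hm hε hkm hmax
      exact ⟨h1, by omega⟩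
    · left
      have hS := sum_nonpendants_deg_le (R := m + 1 + ε) (ε := ε) hG (by omega) hε (by omega)
      refine nonpendantBalanced_of_balancedCactus (S := 6 * m + 6 + 8 * ε + k) hG (by omega) ?_
        (by omega) hmax
      rw [show n - k = 2 * m + 3 + 3 * ε by omega]
      exact balancedCactus_of_le hε (by omega)

theorem isGreatest_cacti_zero {c : ℝ} (hc : 0 < c) {n m ε : ℕ} (hn : n = 2 * m + 3 + 3 * ε)
    (hε : ε ≤ 1) {P : ℝ} (hP : P = (8 ^ (m + 1 + ε) * (9 / 4) ^ ε) ^ c) :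
    IsGreatest (zagrebProd c '' cacti n 0) P ∧
      ∀ G ∈ cacti n 0, G.zagrebProd c = P ↔
        G.degSeq = Multiset.replicate m 4 + Multiset.replicate (2 * ε) 3 +
          Multiset.replicate (m + 3 + ε) 2 := by
  have hprod := prod_family (m := m) (ε := ε) (k := 0) (j := m + 3 + ε) (zero_add _)
  have hfam := cactusDegrees_family (m := m) (k := 0) (j := m + 3 + ε) hε (zero_add _)
  simp only [Multiset.replicate_zero, add_zero, zero_add, pow_zero, mul_one] at hprod hfam
  have hback : ∀ G : SimpleGraph (Fin n), G.degSeq = Multiset.replicate m 4 +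
      Multiset.replicate (2 * ε) 3 + Multiset.replicate (m + 3 + ε) 2 → G.zagrebProd c = P := by
    intro G hG
    rw [zagrebProd_eq, degProd_eq_prod_degSeq, hG, hprod, hP]
  have hbound : ∀ G ∈ cacti n 0, G.degProd ≤ 8 ^ (m + 1 + ε) * (9 / 4) ^ ε := by
    intro G hG
    have hN := card_nonpendants_of_mem_cacti hG
    have := hG.1.prod_nonpendants_le (R := m + 1 + ε) (ε := ε)
      (by rw [Fintype.card_fin]; omega) (by omega) hε
    rwa [hG.2, pow_zero, mul_one, ← degProd_eq_prod_nonpendants] at this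
  refine ⟨⟨?_, ?_⟩, fun G hG => ⟨fun h => ?_, hback G⟩⟩
  · obtain ⟨H, hH, hHs⟩ := exists_mem_cacti hfam (n := n) (k := 0) (by simp; omega)
      (by simp [Multiset.count_replicate])
    exact ⟨H, hH, hback H hHs⟩
  · rintro _ ⟨G, hG, rfl⟩
    rw [zagrebProd_eq, hP]
    exact Real.rpow_le_rpow G.degProd_nonneg (hbound G hG) hc.le
  · have hN := card_nonpendants_of_mem_cacti hG
    rw [zagrebProd_eq, hP, Real.rpow_left_inj G.degProd_nonneg (by positivity) hc.ne',
      degProd_eq_prod_nonpendants] at h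
    have h3 : 3 ≤ Fintype.card (Fin n) := by rw [Fintype.card_fin]; omega
    obtain ⟨h1, hr, hD⟩ := hG.1.isTight_of_le (R := m + 1 + ε) (ε := ε) h3 (by omega) hε
      (by rw [hG.2, pow_zero, mul_one, h])
    exact h1.degSeq_eq hG.1 h3 hG.2 (by rw [Fintype.card_fin, hn]) hr hD

/-- All degrees are at least 2, while the edge count bounds their sum by 8. -/
theorem degSeq_of_mem_cacti_four_zero {G : SimpleGraph (Fin 4)} (hG : G ∈ cacti 4 0) :
    G.degSeq = Multiset.replicate 4 2 := by
  have hN := card_nonpendants_of_mem_cacti hG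
  have hS := sum_nonpendants_deg_le (R := 1) (ε := 1) hG rfl le_rfl le_rfl
  have huniv : G.nonpendants = univ := eq_univ_of_card _ (by rw [Fintype.card_fin]; omega)
  have h2 : ∀ v, 2 ≤ G.deg v := by
    intro v
    have h1 := one_le_deg hG.1.1 (by simp) v
    have hv : v ∈ G.nonpendants := huniv ▸ mem_univ v
    rw [mem_nonpendants] at hv
    omega
  rw [huniv] at hS
  have hle : ∑ v, G.deg v ≤ ∑ _v : Fin 4, 2 := by simp; omega
  have heq := (sum_eq_sum_iff_of_le fun v _ => h2 v).1
    (le_antisymm (sum_le_sum fun v _ => h2 v) hle)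
  rw [degSeq, Multiset.map_congr rfl fun v _ => (heq v (mem_univ v)).symm, Multiset.map_const']
  rfl

theorem isGreatest_cacti_four_zero (c : ℝ) :
    IsGreatest (zagrebProd c '' cacti 4 0) ((16 : ℝ) ^ c) ∧
      ∀ G ∈ cacti 4 0, G.zagrebProd c = (16 : ℝ) ^ c ↔ G.degSeq = Multiset.replicate 4 2 := by
  have hval : ∀ G ∈ cacti 4 0, G.zagrebProd c = (16 : ℝ) ^ c := by
    intro G hG
    rw [zagrebProd_eq, degProd_eq_prod_degSeq, degSeq_of_mem_cacti_four_zero hG]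
    norm_num
  refine ⟨⟨?_, ?_⟩, fun G hG => iff_of_true (hval G hG) (degSeq_of_mem_cacti_four_zero hG)⟩
  · obtain ⟨H, hH, -⟩ := exists_mem_cacti cactusDegrees_four_two (n := 4) (k := 0) rfl
      (by simp)
    exact ⟨H, hH, hval H hH⟩
  · rintro _ ⟨G, hG, rfl⟩
    exact (hval G hG).le

end Extremal

end SimpleGraph

theorem theorem3 (c : ℝ) (hc : 0 < c) :
    (IsGreatest (SimpleGraph.zagrebProd c '' cacti 4 0) ((16 : ℝ) ^ c) ∧
      ∀ G ∈ cacti 4 0, G.zagrebProd c = (16 : ℝ) ^ c ↔ G.degSeq = Multiset.replicate 4 2) ∧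
    (∀ t : ℕ,
      IsGreatest (SimpleGraph.zagrebProd c '' cacti (2 * t + 5) 0)
        ((2 : ℝ) ^ ((3 * (t : ℝ) + 6) * c)) ∧
      ∀ G ∈ cacti (2 * t + 5) 0, G.zagrebProd c = (2 : ℝ) ^ ((3 * (t : ℝ) + 6) * c) ↔
        G.degSeq = Multiset.replicate (t + 1) 4 + Multiset.replicate (t + 4) 2) ∧
    (∀ t : ℕ,
      IsGreatest (SimpleGraph.zagrebProd c '' cacti (2 * t + 6) 0)
        ((2 : ℝ) ^ ((3 * (t : ℝ) + 4) * c) * (9 : ℝ) ^ c) ∧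
      ∀ G ∈ cacti (2 * t + 6) 0,
        G.zagrebProd c = (2 : ℝ) ^ ((3 * (t : ℝ) + 4) * c) * (9 : ℝ) ^ c ↔
        G.degSeq = Multiset.replicate t 4 + Multiset.replicate 2 3 +
          Multiset.replicate (t + 4) 2) ∧
    (∀ n k : ℕ, k ≠ 0 → k + 4 ≤ n → ∀ G ∈ cacti n k,
      (∀ H ∈ cacti n k, H.zagrebProd c ≤ G.zagrebProd c) →
      G.NonpendantBalanced ∨
        ((∀ u, G.deg u ≠ 1 → G.deg u = 2 ∨ G.deg u = 3 ∨ G.deg u = 4) ∧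
          G.CyclesAreTriangles ∧ G.DensePathsRestricted ∧ G.ConnectingPathsRestricted)) := by
  refine ⟨SimpleGraph.isGreatest_cacti_four_zero c, fun t => ?_, fun t => ?_, ?_⟩
  · have hP : (2 : ℝ) ^ ((3 * (t : ℝ) + 6) * c) =
        (8 ^ (t + 1 + 1 + 0) * (9 / 4) ^ 0) ^ c := by
      rw [Real.rpow_mul (by norm_num), pow_zero, mul_one,
        show 3 * (t : ℝ) + 6 = (3 * (t + 1 + 1 + 0) : ℕ) by push_cast; ring, Real.rpow_natCast,
        pow_mul]
      norm_num
    simpa using SimpleGraph.isGreatest_cacti_zero hc (n := 2 * t + 5) (m := t + 1) (ε := 0)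
      (by ring) (by norm_num) hP
  · have hP : (2 : ℝ) ^ ((3 * (t : ℝ) + 4) * c) * (9 : ℝ) ^ c =
        (8 ^ (t + 1 + 1) * (9 / 4) ^ 1) ^ c := by
      rw [Real.rpow_mul (by norm_num), ← Real.mul_rpow (by positivity) (by norm_num),
        show 3 * (t : ℝ) + 4 = (3 * t + 4 : ℕ) by push_cast; ring, Real.rpow_natCast,
        pow_add, pow_mul]
      congr 1
      ring
    simpa using SimpleGraph.isGreatest_cacti_zero hc (n := 2 * t + 6) (m := t) (ε := 1)
      (by ring) le_rfl hP
  · intro n k hk hn G hG hmax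
    have h3 : 3 ≤ Fintype.card (Fin n) := by rw [Fintype.card_fin]; omega
    refine (SimpleGraph.nonpendantBalanced_or_isTight hk hn hG fun H hH =>
      (SimpleGraph.zagrebProd_le_iff hc).1 (hmax H hH)).imp_right ?_
    rintro ⟨ht, hD⟩
    exact ⟨fun u hu => ht.deg_eq hG.1 hu, ht.cyclesAreTriangles, ht.densePathsRestricted hG.1 h3,
      ht.connectingPathsRestricted hD⟩
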